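/- Let $n\ge 1$ and let $\mathbb H^{n,1}$ be the right quaternionic vector space $\mathbb H^{n+1}$ with the Hermitian form $$\langle z,w\rangle=w^*Jz=\overline{w_1}z_1+\cdots+\overline{w_{n-1}}z_{n-1}-(\overline{w_n}z_{n+1}+\overline{w_{n+1}}z_n).$$ Let $Sp(n,1)$ be the group of quaternionic matrices preserving this form, acting on the right quaternionic lines of $\mathbb H^{n,1}$. Quaternionic hyperbolic space $H^n_{\mathbb H}$ is the set of lines spanned by vectors $z$ with $\langle z,z\rangle<0$, and $\partial H^n_{\mathbb H}$ is the set of lines spanned by vectors $z\ne0$ with $\langle z,z\rangle=0$. Fixed points of an element are taken in $H^n_{\mathbb H}\cup\partial H^n_{\mathbb H}$. An element $\ne 1$ of $Sp(n,1)$ is elliptic if it has a fixed point in $H^n_{\mathbb H}$, and loxodromic if it has exactly two fixed points and these lie in $\partial H^n_{\mathbb H}$. A subgroup of $Sp(n,1)$ is non-elementary if it contains two non-elliptic elements of infinite order having no common fixed point; otherwise it is elementary. A subgroup is discrete if it is discrete in the topology of matrices. A loxodromic $g$ is conjugate in $Sp(n,1)$ to a matrix $\mathrm{diag}(\lambda_1,\dots,\lambda_{n+1})$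 with $|\lambda_i|=1$ for $1\le i\le n-1$, $|\lambda_n|\ne1$ and $\overline{\lambda_n}\lambda_{n+1}=1$ (the $\lambda_i$ are right eigenvalues of $g$). Put $$\delta(g)=\max_{1\le i\le n-1}|\lambda_i-1|\quad(\delta(g)=0\text{ if }n=1),\qquad M_g=2\delta(g)+|\lambda_n-1|+|\lambda_{n+1}-1| ;$$ these do not depend on the chosen diagonal form. For points $z_1,z_2,w_1,w_2$ of $H^n_{\mathbb H}\cup\partial H^n_{\mathbb H}$ with lifts $\mathbf z_i,\mathbf w_i$ put $$[z_1,z_2,w_1,w_2]=\langle \mathbf w_1,\mathbf z_1\rangle\langle \mathbf w_1,\mathbf z_2\rangle^{-1}\langle \mathbf w_2,\mathbf z_2\rangle\langle \mathbf w_2,\mathbf z_1\rangle^{-1},$$ whose modulus does not depend on the lifts. **Theorem.** Let $g,h\in Sp(n,1)$, where $g$ is loxodromic with fixed points $u,v$. If $$M_g\bigl(1+|[h(u),v,u,h(v)]|^{1/2}\bigr)<1\quad\text{or}\quad M_g\bigl(1+|[h(u),u,v,h(v)]|^{1/2}\bigr)<1,$$ then the group $\langle g,h\rangle$ is either elementary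 or not discrete. -/

import Mathlib

open scoped Quaternion Matrix LinearAlgebra.Projectivization

noncomputable section

namespace QuatHyp

/-- Index set of the `n + 1` coordinates of `ℍ^{n,1}` (for `n ≥ 1`): `Sum.inl i` are the first
`n - 1` coordinates, `Sum.inr 0` is the `n`-th one and `Sum.inr 1` is the `(n+1)`-st one. -/
abbrev Idx (n : ℕ) : Type := Fin (n - 1) ⊕ Fin 2

/-- Column vectors with `n + 1` quaternionic entries; as a right quaternionic vector space this is
a module over `ℍᵐᵒᵖ`. -/
abbrev Vec (n : ℕ) : Type := Idx n → ℍ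

/-- The matrix `J` of the Hermitian form: the identity on the first `n - 1` coordinates and
`!![0, -1; -1, 0]` on the last two. -/
def J (n : ℕ) : Matrix (Idx n) (Idx n) ℍ :=
  Matrix.fromBlocks 1 0 0 !![0, -1; -1, 0]

/-- The Hermitian form `⟨z, w⟩ = w* J z` of signature `(n, 1)`. -/
def herm {n : ℕ} (z w : Vec n) : ℍ := star w ⬝ᵥ (J n *ᵥ z)

/-- `Sp(n,1)`: the invertible quaternionic matrices `g` with `g* J g = J`, i.e. those which preserve
the Hermitian form (see `mem_Sp_iff_herm`). -/
def Sp (n : ℕ) : Subgroup (Matrix (Idx n) (Idx n) ℍ)ˣ where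
  carrier := {g | (g : Matrix (Idx n) (Idx n) ℍ)ᴴ * J n * (g : Matrix (Idx n) (Idx n) ℍ) = J n}
  one_mem' := by simp
  mul_mem' := by
    intro a b ha hb
    simp only [Set.mem_ofPred_eq, Units.val_mul, Matrix.conjTranspose_mul] at ha hb ⊢
    calc _ = (b : Matrix (Idx n) (Idx n) ℍ)ᴴ *
          ((a : Matrix (Idx n) (Idx n) ℍ)ᴴ * J n * (a : Matrix (Idx n) (Idx n) ℍ)) *
          (b : Matrix (Idx n) (Idx n) ℍ) := by simp only [Matrix.mul_assoc]
      _ = J n := by rw [ha, hb]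
  inv_mem' := by
    intro a ha
    simp only [Set.mem_ofPred_eq] at ha ⊢
    have h1 : (a : Matrix (Idx n) (Idx n) ℍ) * ((a⁻¹ : (Matrix (Idx n) (Idx n) ℍ)ˣ) :
      Matrix (Idx n) (Idx n) ℍ) = 1 := a.mul_inv
    have h2 : ((a⁻¹ : (Matrix (Idx n) (Idx n) ℍ)ˣ) : Matrix (Idx n) (Idx n) ℍ)ᴴ *
      (a : Matrix (Idx n) (Idx n) ℍ)ᴴ = 1 := by
      rw [← Matrix.conjTranspose_mul, h1, Matrix.conjTranspose_one]
    generalize ((a⁻¹ : (Matrix (Idx n) (Idx n) ℍ)ˣ) : Matrix (Idx n) (Idx n) ℍ) = b at h1 h2 ⊢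
    calc bᴴ * J n * b = bᴴ * ((a : Matrix (Idx n) (Idx n) ℍ)ᴴ * J n *
          (a : Matrix (Idx n) (Idx n) ℍ)) * b := by rw [ha]
      _ = (bᴴ * (a : Matrix (Idx n) (Idx n) ℍ)ᴴ) * J n *
          ((a : Matrix (Idx n) (Idx n) ℍ) * b) := by simp only [Matrix.mul_assoc]
      _ = J n := by rw [h1, h2, Matrix.one_mul, Matrix.mul_one]

/-- The underlying matrix of an element of `Sp(n,1)`. -/
def mat {n : ℕ} (g : Sp n) : Matrix (Idx n) (Idx n) ℍ := ((g : (Matrix (Idx n) (Idx n) ℍ)ˣ) : _)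

/-- `Sp(n,1)` consists of the invertible matrices preserving the Hermitian form. -/
theorem mem_Sp_iff_herm {n : ℕ} (g : (Matrix (Idx n) (Idx n) ℍ)ˣ) :
    g ∈ Sp n ↔ ∀ z w : Vec n,
      herm ((g : Matrix (Idx n) (Idx n) ℍ) *ᵥ z) ((g : Matrix (Idx n) (Idx n) ℍ) *ᵥ w) =
        herm z w := by
  have key : ∀ z w : Vec n,
      herm ((g : Matrix (Idx n) (Idx n) ℍ) *ᵥ z) ((g : Matrix (Idx n) (Idx n) ℍ) *ᵥ w) =
      star w ⬝ᵥ (((g : Matrix (Idx n) (Idx n) ℍ)ᴴ * J n * (g : Matrix (Idx n) (Idx n) ℍ)) *ᵥ z) := by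
    intro z w
    simp only [herm, Matrix.star_mulVec, Matrix.mulVec_mulVec, Matrix.dotProduct_mulVec,
      Matrix.vecMul_vecMul, Matrix.mul_assoc]
  constructor
  · intro hg z w
    rw [key, show (g : Matrix (Idx n) (Idx n) ℍ)ᴴ * J n * (g : Matrix (Idx n) (Idx n) ℍ) = J n
      from hg, herm]
  · intro hg
    change (g : Matrix (Idx n) (Idx n) ℍ)ᴴ * J n * (g : Matrix (Idx n) (Idx n) ℍ) = J n
    ext1 i j
    have h := hg (Pi.single j 1) (Pi.single i 1)
    rw [key] at h
    simpa [herm, ← Pi.single_star] using h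

/-- The projective space of right quaternionic lines in `ℍ^{n,1}`. The group `Sp(n,1)` acts on it
through multiplication of column vectors by matrices (see `smul_mk_eq`). -/
abbrev Pt (n : ℕ) : Type := ℙ ℍᵐᵒᵖ (Vec n)

/-- The action of `Sp(n,1)` on lines is induced by matrix multiplication. -/
theorem smul_mk_eq {n : ℕ} (g : Sp n) (z : Vec n) (hz : z ≠ 0) :
    ∃ h : mat g *ᵥ z ≠ 0,
      g • (Projectivization.mk ℍᵐᵒᵖ z hz : Pt n) = Projectivization.mk ℍᵐᵒᵖ (mat g *ᵥ z) h :=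
  ⟨(smul_ne_zero_iff_ne g).mpr hz, rfl⟩

theorem herm_smul_smul {n : ℕ} (a b : ℍᵐᵒᵖ) (z w : Vec n) :
    herm (a • z) (b • w) = star b.unop * herm z w * a.unop := by
  have h1 : J n *ᵥ (a • z) = a • (J n *ᵥ z) := Matrix.mulVec_smul _ _ _
  rw [herm, h1, herm]
  simp only [dotProduct, Finset.mul_sum, Finset.sum_mul, Pi.star_apply, Pi.smul_apply,
    MulOpposite.smul_eq_mul_unop, star_mul, mul_assoc]

/-- Quaternionic hyperbolic `n`-space: the lines on which `⟨z, z⟩ < 0` (recall that `⟨z, z⟩` is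
always real). -/
def hypSpace (n : ℕ) : Set (Pt n) := {p | (herm p.rep p.rep).re < 0}

/-- The boundary of quaternionic hyperbolic `n`-space: the null lines. -/
def bdry (n : ℕ) : Set (Pt n) := {p | herm p.rep p.rep = 0}

theorem mk_mem_hypSpace {n : ℕ} (z : Vec n) (hz : z ≠ 0) :
    Projectivization.mk ℍᵐᵒᵖ z hz ∈ hypSpace n ↔ (herm z z).re < 0 := by
  obtain ⟨a, ha⟩ := Projectivization.exists_smul_eq_mk_rep ℍᵐᵒᵖ z hz
  have ha0 : 0 < Quaternion.normSq (a : ℍᵐᵒᵖ).unop :=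
    lt_of_le_of_ne Quaternion.normSq_nonneg (Ne.symm (by simp))
  rw [hypSpace, Set.mem_ofPred_eq, ← ha, Units.smul_def, herm_smul_smul]
  have : (star (a : ℍᵐᵒᵖ).unop * herm z z * (a : ℍᵐᵒᵖ).unop).re =
      Quaternion.normSq (a : ℍᵐᵒᵖ).unop * (herm z z).re := by
    simp only [Quaternion.normSq_def', Quaternion.re_mul, Quaternion.imI_mul, Quaternion.imJ_mul,
      Quaternion.imK_mul, Quaternion.re_star, Quaternion.imI_star, Quaternion.imJ_star,
      Quaternion.imK_star]
    ring
  rw [this, mul_neg_iff]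
  constructor
  · rintro (h | h)
    · exact h.2
    · exact absurd h.1 (not_lt.mpr ha0.le)
  · exact fun h => Or.inl ⟨ha0, h⟩

theorem mk_mem_bdry {n : ℕ} (z : Vec n) (hz : z ≠ 0) :
    Projectivization.mk ℍᵐᵒᵖ z hz ∈ bdry n ↔ herm z z = 0 := by
  obtain ⟨a, ha⟩ := Projectivization.exists_smul_eq_mk_rep ℍᵐᵒᵖ z hz
  rw [bdry, Set.mem_ofPred_eq, ← ha, Units.smul_def, herm_smul_smul]
  simp

/-- The fixed points of `g` in the closure of quaternionic hyperbolic space. -/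
def fixedPts {n : ℕ} (g : Sp n) : Set (Pt n) := {p | p ∈ hypSpace n ∪ bdry n ∧ g • p = p}

/-- A non-trivial element is elliptic if it has a fixed point in hyperbolic space. -/
def IsElliptic {n : ℕ} (g : Sp n) : Prop := g ≠ 1 ∧ (fixedPts g ∩ hypSpace n).Nonempty

/-- A non-trivial element is loxodromic if it has exactly two fixed points in the closure of
hyperbolic space, and these lie in the boundary. -/
def IsLoxodromic {n : ℕ} (g : Sp n) : Prop :=
  g ≠ 1 ∧ (fixedPts g).ncard = 2 ∧ fixedPts g ⊆ bdry n

/-- A subgroup is non-elementary if it contains two non-elliptic elements of infinite order with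
distinct fixed points (that is, without a common fixed point); otherwise it is elementary. -/
def IsElementary {n : ℕ} (G : Subgroup (Sp n)) : Prop :=
  ¬ ∃ a ∈ G, ∃ b ∈ G, ¬ IsElliptic a ∧ ¬ IsElliptic b ∧ ¬ IsOfFinOrder a ∧ ¬ IsOfFinOrder b ∧
    Disjoint (fixedPts a) (fixedPts b)

/-- A subgroup of `Sp(n,1)` is discrete if the matrix topology induces the discrete topology
on it. -/
def IsDiscreteSubgroup {n : ℕ} (G : Subgroup (Sp n)) : Prop := DiscreteTopology G

/-- `diag(lam)` is a diagonal form of `g`: `g` is conjugate in `Sp(n,1)` to the diagonal matrix with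
entries `λ₁, …, λ_{n+1}`, where `|λ_i| = 1` for `i < n`, `|λ_n| ≠ 1` and `conj(λ_n) λ_{n+1} = 1`. -/
def IsDiagForm {n : ℕ} (g : Sp n) (lam : Idx n → ℍ) : Prop :=
  (∃ f : Sp n, mat (f * g * f⁻¹) = Matrix.diagonal lam) ∧
    (∀ i, ‖lam (Sum.inl i)‖ = 1) ∧ ‖lam (Sum.inr 0)‖ ≠ 1 ∧
    star (lam (Sum.inr 0)) * lam (Sum.inr 1) = 1

open Classical in
/-- The diagonal entries `λ₁, …, λ_{n+1}` of a diagonal form of `g`; they are right eigenvalues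
of `g`. A loxodromic `g` has such a form (the value for a `g` without one is irrelevant). The form
is unique up to replacing each `λ_i` by a similar quaternion, permuting `λ₁, …, λ_{n-1}` and
exchanging `λ_n` and `λ_{n+1}`; the quantities `delta` and `Mg` below do not depend on
the choice (see `IsDiagForm.delta_eq_and_Mg_eq`). -/
def eigs {n : ℕ} (g : Sp n) : Idx n → ℍ :=
  if h : ∃ lam, IsDiagForm g lam then h.choose else 1

/-- `δ(g) = max_{1 ≤ i ≤ n-1} |λ_i - 1|` (the empty maximum, for `n = 1`, is `0`). -/
def delta {n : ℕ} (g : Sp n) : ℝ := ⨆ i : Fin (n - 1), ‖eigs g (Sum.inl i) - 1‖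

/-- `M_g = 2 δ(g) + |λ_n - 1| + |λ_{n+1} - 1|`. -/
def Mg {n : ℕ} (g : Sp n) : ℝ :=
  2 * delta g + ‖eigs g (Sum.inr 0) - 1‖ + ‖eigs g (Sum.inr 1) - 1‖

/-- Two diagonal forms of the same element have the same entries up to similarity and order. -/
theorem IsDiagForm.exists_match {n : ℕ} {g : Sp n} {l l' : Idx n → ℍ}
    (h : IsDiagForm g l) (h' : IsDiagForm g l') (i : Idx n) :
    ∃ j, ‖l i‖ = ‖l' j‖ ∧ ‖l i - 1‖ = ‖l' j - 1‖ := by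
  obtain ⟨⟨f, hf⟩, -⟩ := h
  obtain ⟨⟨f', hf'⟩, -⟩ := h'
  set c : Sp n := f * f'⁻¹ with hc
  have e : Matrix.diagonal l * mat c = mat c * Matrix.diagonal l' := by
    rw [← hf, ← hf']
    have : (f * g * f⁻¹) * c = c * (f' * g * f'⁻¹) := by rw [hc]; group
    exact congrArg mat this
  have hrow : ∃ j, mat c i j ≠ 0 := by
    by_contra! hz
    have h1 : mat c * mat c⁻¹ = 1 := congrArg mat (mul_inv_cancel c)
    have h2 := congrFun (congrFun h1 i) i
    rw [Matrix.mul_apply, Finset.sum_eq_zero (fun j _ => by rw [hz j, zero_mul])] at h2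
    simp at h2
  obtain ⟨j, hj⟩ := hrow
  have e' : l i * mat c i j = mat c i j * l' j := by
    have := congrFun (congrFun e i) j
    rwa [Matrix.diagonal_mul, Matrix.mul_diagonal] at this
  have hn : ‖mat c i j‖ ≠ 0 := norm_ne_zero_iff.mpr hj
  refine ⟨j, ?_, ?_⟩
  · have := congrArg norm e'
    rw [norm_mul, norm_mul, mul_comm] at this
    exact mul_left_cancel₀ hn this
  · have e2 : (l i - 1) * mat c i j = mat c i j * (l' j - 1) := by
      rw [sub_mul, mul_sub, e', one_mul, mul_one]
    have := congrArg norm e2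
    rw [norm_mul, norm_mul, mul_comm] at this
    exact mul_left_cancel₀ hn this

/-- `delta` and `Mg` may be computed with any diagonal form. -/
theorem IsDiagForm.delta_eq_and_Mg_eq {n : ℕ} {g : Sp n} {l : Idx n → ℍ} (h : IsDiagForm g l) :
    delta g = (⨆ i : Fin (n - 1), ‖l (Sum.inl i) - 1‖) ∧
      Mg g = 2 * (⨆ i : Fin (n - 1), ‖l (Sum.inl i) - 1‖) +
        ‖l (Sum.inr 0) - 1‖ + ‖l (Sum.inr 1) - 1‖ := by
  have hk : IsDiagForm g (eigs g) := by
    have hex : ∃ lam, IsDiagForm g lam := ⟨l, h⟩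
    rw [eigs, dif_pos hex]
    exact hex.choose_spec
  -- The norms of the last two entries: both differ from one, and they differ from each other.
  have last : ∀ {m : Idx n → ℍ}, IsDiagForm g m → ‖m (Sum.inr 1)‖ ≠ 1 ∧
      ‖m (Sum.inr 0)‖ ≠ ‖m (Sum.inr 1)‖ := by
    rintro m ⟨-, -, h0, h1⟩
    have h2 := congrArg norm h1
    rw [norm_mul, Quaternion.norm_star, norm_one] at h2
    refine ⟨fun h3 => h0 (by rwa [h3, mul_one] at h2), fun h3 => h0 ?_⟩
    rw [← h3] at h2
    nlinarith [norm_nonneg (m (Sum.inr 0))]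
  have le : ∀ {m m' : Idx n → ℍ}, IsDiagForm g m → IsDiagForm g m' →
      (⨆ i : Fin (n - 1), ‖m (Sum.inl i) - 1‖) ≤ ⨆ i : Fin (n - 1), ‖m' (Sum.inl i) - 1‖ := by
    intro m m' hm hm'
    refine Real.iSup_le (fun i => ?_) (Real.iSup_nonneg fun i => norm_nonneg _)
    obtain ⟨j, hj, hj'⟩ := hm.exists_match hm' (Sum.inl i)
    rw [hm.2.1 i] at hj
    rcases j with j | j
    · rw [hj']
      exact le_ciSup (f := fun i : Fin (n - 1) => ‖m' (Sum.inl i) - 1‖)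
        (Set.finite_range _).bddAbove j
    · fin_cases j
      · exact absurd hj.symm hm'.2.2.1
      · exact absurd hj.symm (last hm').1
  have hd : delta g = ⨆ i : Fin (n - 1), ‖l (Sum.inl i) - 1‖ := le_antisymm (le hk h) (le h hk)
  refine ⟨hd, ?_⟩
  rw [Mg, hd]
  have mt : ∀ k : Fin 2, ∃ j : Fin 2, ‖eigs g (Sum.inr k)‖ = ‖l (Sum.inr j)‖ ∧
      ‖eigs g (Sum.inr k) - 1‖ = ‖l (Sum.inr j) - 1‖ := by
    intro k
    obtain ⟨j, hj, hj'⟩ := hk.exists_match h (Sum.inr k)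
    rcases j with j | j
    · rw [h.2.1 j] at hj
      fin_cases k
      · exact absurd hj hk.2.2.1
      · exact absurd hj (last hk).1
    · exact ⟨j, hj, hj'⟩
  obtain ⟨a, ha, ha'⟩ := mt 0
  obtain ⟨b, hb, hb'⟩ := mt 1
  have hab : a ≠ b := fun hab => (last hk).2 (by rw [ha, hb, hab])
  rw [ha', hb']
  fin_cases a <;> fin_cases b <;> first | exact absurd rfl hab | simp; done | (simp; ring)

/-- The quaternionic cross-ratio
`[z₁, z₂, w₁, w₂] = ⟨w₁, z₁⟩ ⟨w₁, z₂⟩⁻¹ ⟨w₂, z₂⟩ ⟨w₂, z₁⟩⁻¹` of four vectors. -/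
def crossRatio {n : ℕ} (z₁ z₂ w₁ w₂ : Vec n) : ℍ :=
  herm w₁ z₁ * (herm w₁ z₂)⁻¹ * herm w₂ z₂ * (herm w₂ z₁)⁻¹

/-- The modulus `|[p₁, p₂, q₁, q₂]|` of the cross-ratio of four points; it does not depend on the
vectors representing the points. -/
def absCrossRatio {n : ℕ} (p₁ p₂ q₁ q₂ : Pt n) : ℝ :=
  ‖crossRatio p₁.rep p₂.rep q₁.rep q₂.rep‖

/-- The modulus of the cross-ratio can be computed with any vectors representing the points. -/
theorem absCrossRatio_mk {n : ℕ} {z₁ z₂ w₁ w₂ : Vec n} (hz₁ : z₁ ≠ 0) (hz₂ : z₂ ≠ 0)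
    (hw₁ : w₁ ≠ 0) (hw₂ : w₂ ≠ 0) :
    absCrossRatio (.mk ℍᵐᵒᵖ z₁ hz₁) (.mk ℍᵐᵒᵖ z₂ hz₂) (.mk ℍᵐᵒᵖ w₁ hw₁) (.mk ℍᵐᵒᵖ w₂ hw₂) =
      ‖crossRatio z₁ z₂ w₁ w₂‖ := by
  obtain ⟨a, ha⟩ := Projectivization.exists_smul_eq_mk_rep ℍᵐᵒᵖ z₁ hz₁
  obtain ⟨b, hb⟩ := Projectivization.exists_smul_eq_mk_rep ℍᵐᵒᵖ z₂ hz₂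
  obtain ⟨c, hc⟩ := Projectivization.exists_smul_eq_mk_rep ℍᵐᵒᵖ w₁ hw₁
  obtain ⟨d, hd⟩ := Projectivization.exists_smul_eq_mk_rep ℍᵐᵒᵖ w₂ hw₂
  have ha0 : ‖(a : ℍᵐᵒᵖ).unop‖ ≠ 0 := by simp
  have hb0 : ‖(b : ℍᵐᵒᵖ).unop‖ ≠ 0 := by simp
  have hc0 : ‖(c : ℍᵐᵒᵖ).unop‖ ≠ 0 := by simp
  have hd0 : ‖(d : ℍᵐᵒᵖ).unop‖ ≠ 0 := by simp
  rw [absCrossRatio, ← ha, ← hb, ← hc, ← hd]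
  simp only [crossRatio, Units.smul_def, herm_smul_smul, norm_mul, norm_inv, Quaternion.norm_star,
    mul_inv]
  field_simp

end QuatHyp

end

open scoped Quaternion Matrix LinearAlgebra.Projectivization

noncomputable section

namespace QuatHyp

variable {n : ℕ}

open Filter Topology

/-! Conjugate so that `u`, `v` are the two standard null points and `g = diag(λ_i)`. Let `a, b, c,
d` be the entries of `h` in its last two rows and columns. The two cross-ratios then have moduli
`|bc|` and `|ad|`. Ptolemy's inequality for null vectors (`sqrt_norm_herm_mul_le`), applied to the
two fixed points and their images under `h`, says that `1`, `|ad|^{1/2}`, `|bc|^{1/2}` satisfy the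
triangle inequalities.

Iterate `h_0 = h`, `h_{k+1} = h_k g h_k⁻¹` (`conjSeq`). Since `h J h* = J`, the off-diagonal corners
of `h g h⁻¹` are linear in the numbers `λ_i - 1`, and Cauchy–Schwarz bounds `|bc|^{1/2}` after one
step by `M_g |ad|^{1/2} |bc|^{1/2}`. Together with `|ad|^{1/2} ≤ 1 + |bc|^{1/2}` and the hypothesis
this gives `|b_k c_k| → 0` and `|a_k d_k| → 1`. The diagonal corners then tend in modulus to `|λ_n|`
and `|λ_{n+1}|`. One of `b_k`, `c_k` may still grow by itself, but `g^{-k} h_{2k} g^k`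
(`twistedSeq`) has bounded entries, and its off-diagonal corners tend to `0`.

If the group is discrete, a subsequence of these elements is eventually constant. Its value has
vanishing off-diagonal corners, so it fixes `u` and `v`, and therefore so does some `h_{2k}` with `k
≥ 1`. Descend from there: if `h_{k+1} = h_k g h_k⁻¹` fixes `u` and `v`, then `h_k` preserves `{u,
v}`. For `k ≥ 1` it cannot exchange them, because an exchange has a fixed point in hyperbolic space
while `h_k` is conjugate to `g`. Hence `h_1` fixes both points, `h` preserves `{u, v}`, and so does
the whole group. Its non-elliptic elements all fix `u`, which makes it elementary. -/

/-! ### Spectral theorem for quaternionic unitary matrices -/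

/-- A quaternionic matrix has a right eigenvector in every non-zero invariant right subspace. -/
theorem exists_right_eigenvector {m : ℕ} (A : Matrix (Fin m) (Fin m) ℍ)
    (W : Submodule ℍᵐᵒᵖ (Fin m → ℍ)) (hW : W ≠ ⊥) (hA : ∀ x ∈ W, A *ᵥ x ∈ W) :
    ∃ x ∈ W, x ≠ 0 ∧ ∃ q : ℍᵐᵒᵖ, A *ᵥ x = q • x := by
  -- Since `ℂ` is commutative, it embeds in the opposite algebra. Right multiplication thus makes
  -- `W` a finite-dimensional complex space on which `A` is linear, and a complex eigenvalue exists.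
  let φ : ℂ →+* ℍᵐᵒᵖ := (Quaternion.ofComplex : ℂ →+* ℍ).toOpposite
    (fun x y => by rw [Commute, SemiconjBy, ← map_mul, ← map_mul, mul_comm])
  let _ : Module ℂ W := Module.compHom W φ
  have hsmul : ∀ (z : ℂ) (x : W), z • x = φ z • x := fun _ _ => rfl
  have : IsScalarTower ℝ ℂ W := by
    refine ⟨fun r z x => ?_⟩
    rw [hsmul, hsmul]
    have : φ (r • z) = r • φ z := by
      apply MulOpposite.unop_injective
      change Quaternion.ofComplex (r • z) = r • Quaternion.ofComplex z
      exact map_smul _ _ _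
    rw [this, smul_assoc]
  have : Module.Finite ℝ W :=
    Module.Finite.of_injective (W.subtype.restrictScalars ℝ) W.injective_subtype
  have : Module.Finite ℂ W := Module.Finite.of_restrictScalars_finite ℝ ℂ W
  have : Nontrivial W := Submodule.nontrivial_iff_ne_bot.mpr hW
  let T : Module.End ℂ W :=
    { toFun := fun x => ⟨A *ᵥ x, hA x x.2⟩
      map_add' := fun x y => Subtype.ext (Matrix.mulVec_add A (x : Fin m → ℍ) y)
      map_smul' := fun z x => Subtype.ext (Matrix.mulVec_smul A (φ z) (x : Fin m → ℍ)) }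
  obtain ⟨c, hc⟩ := Module.End.exists_eigenvalue T
  obtain ⟨x, hx⟩ := hc.exists_hasEigenvector
  refine ⟨x, x.2, fun h => hx.2 (Subtype.ext h), φ c, ?_⟩
  exact congrArg Subtype.val hx.apply_eq_smul

theorem star_dotProduct_self {ι : Type*} [Fintype ι] (x : ι → ℍ) :
    star x ⬝ᵥ x = ((∑ i, ‖x i‖ ^ 2 : ℝ) : ℍ) := by
  have h : ((∑ i, ‖x i‖ ^ 2 : ℝ) : ℍ) = ∑ i, ((‖x i‖ ^ 2 : ℝ) : ℍ) :=
    map_sum (algebraMap ℝ ℍ) _ _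
  rw [dotProduct, h]
  refine Finset.sum_congr rfl fun i _ => ?_
  rw [Pi.star_apply, Quaternion.star_mul_self, Quaternion.normSq_eq_norm_mul_self, sq]

theorem star_smul_dotProduct_smul {ι : Type*} [Fintype ι] (a b : ℍᵐᵒᵖ) (x y : ι → ℍ) :
    star (a • x) ⬝ᵥ (b • y) = star a.unop * (star x ⬝ᵥ y) * b.unop := by
  simp only [dotProduct, Finset.mul_sum, Finset.sum_mul, Pi.star_apply, Pi.smul_apply,
    MulOpposite.smul_eq_mul_unop, star_mul, mul_assoc]

theorem star_mulVec_dotProduct_mulVec {ι : Type*} [Fintype ι] [DecidableEq ι]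
    {A : Matrix ι ι ℍ} (hA : Aᴴ * A = 1) (x y : ι → ℍ) :
    star (A *ᵥ x) ⬝ᵥ (A *ᵥ y) = star x ⬝ᵥ y := by
  rw [Matrix.star_mulVec, ← Matrix.dotProduct_mulVec, Matrix.mulVec_mulVec, hA, Matrix.one_mulVec]

/-- Gram–Schmidt style induction: the orthogonal complement of the eigenvectors already found is
invariant, because `A` is unitary, and it contains another eigenvector. -/
theorem exists_orthonormal_eigenvectors {m : ℕ} {A : Matrix (Fin m) (Fin m) ℍ}
    (hA : Aᴴ * A = 1) (k : ℕ) (hk : k ≤ m) :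
    ∃ (v : Fin k → Fin m → ℍ) (q : Fin k → ℍᵐᵒᵖ),
      (∀ i j, star (v i) ⬝ᵥ v j = if i = j then 1 else 0) ∧ ∀ i, A *ᵥ v i = q i • v i := by
  induction k with
  | zero => exact ⟨fun i => i.elim0, fun i => i.elim0, fun i => i.elim0, fun i => i.elim0⟩
  | succ k ih =>
    obtain ⟨v, q, hv, hq⟩ := ih (by omega)
    let T : (Fin m → ℍ) →ₗ[ℍᵐᵒᵖ] (Fin k → ℍ) :=
      { toFun := fun w i => star (v i) ⬝ᵥ w
        map_add' := fun x y => by ext1 i; exact dotProduct_add _ _ _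
        map_smul' := fun a x => by ext1 i; exact dotProduct_smul _ _ _ }
    -- Real dimensions: an injective `T` would give `4m ≤ 4k`, but `k < m`.
    have hker : T.ker ≠ ⊥ := by
      intro hbot
      have hi : Function.Injective (T.restrictScalars ℝ) :=
        (LinearMap.ker_eq_bot.mp hbot : Function.Injective T)
      have := LinearMap.finrank_le_finrank_of_injective hi
      rw [Module.finrank_pi_fintype, Module.finrank_pi_fintype] at this
      simp [Quaternion.finrank_eq_four] at this
      omega
    have hmem : ∀ w, w ∈ T.ker ↔ ∀ i, star (v i) ⬝ᵥ w = 0 := by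
      intro w
      rw [LinearMap.mem_ker]
      exact funext_iff
    have hinv : ∀ x ∈ T.ker, A *ᵥ x ∈ T.ker := by
      intro x hx
      rw [hmem] at hx ⊢
      intro i
      have h1 : star (q i • v i) ⬝ᵥ (A *ᵥ x) = 0 := by
        rw [← hq, star_mulVec_dotProduct_mulVec hA, hx]
      have h2 : star (q i • v i) ⬝ᵥ (q i • v i) = 1 := by
        rw [← hq, star_mulVec_dotProduct_mulVec hA, hv, if_pos rfl]
      have hq0 : (q i).unop ≠ 0 := by
        intro h0
        rw [star_smul_dotProduct_smul, h0, mul_zero] at h2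
        exact zero_ne_one h2
      have h3 := star_smul_dotProduct_smul (q i) 1 (v i) (A *ᵥ x)
      rw [one_smul, h1, MulOpposite.unop_one, mul_one] at h3
      exact (mul_eq_zero.mp h3.symm).resolve_left (star_ne_zero.mpr hq0)
    obtain ⟨x, hx, hx0, c, hc⟩ := exists_right_eigenvector A T.ker hker hinv
    set r : ℝ := ∑ i, ‖x i‖ ^ 2 with hr
    have hrpos : 0 < r := by
      obtain ⟨i, hi⟩ := Function.ne_iff.mp hx0
      exact Finset.sum_pos' (fun _ _ => by positivity)
        ⟨i, Finset.mem_univ i, by have := norm_pos_iff.mpr hi; positivity⟩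
    set s : ℍᵐᵒᵖ := MulOpposite.op (((√r)⁻¹ : ℝ) : ℍ) with hs
    have hs0 : s ≠ 0 := by
      have : ((√r : ℝ) : ℍ) ≠ 0 := fun h =>
        (Real.sqrt_pos.mpr hrpos).ne' (Quaternion.coe_injective (h.trans Quaternion.coe_zero.symm))
      simpa [hs] using this
    set y := s • x with hy
    have hyy : star y ⬝ᵥ y = 1 := by
      rw [hy, star_smul_dotProduct_smul, star_dotProduct_self, ← hr, hs, MulOpposite.unop_op,
        Quaternion.star_coe, ← Quaternion.coe_mul, ← Quaternion.coe_mul, ← Quaternion.coe_one]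
      congr 1
      have := Real.mul_self_sqrt hrpos.le
      have h0 := (Real.sqrt_pos.mpr hrpos).ne'
      field_simp
      linarith
    have hvy : ∀ i, star (v i) ⬝ᵥ y = 0 := (hmem y).mp (T.ker.smul_mem s hx)
    have hyv : ∀ i, star y ⬝ᵥ v i = 0 := by
      intro i
      have := congrArg star (hvy i)
      rwa [← Matrix.star_dotProduct_star, star_star, star_zero] at this
    -- Rescaling a right eigenvector conjugates its eigenvalue, hence `s * c * s⁻¹`.
    refine ⟨Fin.snoc v y, Fin.snoc q (s * c * s⁻¹), ?_, ?_⟩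
    · intro i j
      refine Fin.lastCases ?_ (fun i => ?_) i <;> refine Fin.lastCases ?_ (fun j => ?_) j
      · simp [hyy]
      · simp [hyv, (Fin.castSucc_lt_last j).ne']
      · simp [hvy, (Fin.castSucc_lt_last i).ne]
      · simp [hv]
    · intro i
      refine Fin.lastCases ?_ (fun i => ?_) i
      · simp only [Fin.snoc_last]
        rw [hy, Matrix.mulVec_smul, hc, smul_smul, smul_smul, mul_assoc, inv_mul_cancel₀ hs0,
          mul_one]
      · simp [hq]

/-- The spectral theorem for quaternionic unitary matrices. -/
theorem exists_unitary_diagonalization {m : ℕ} {A : Matrix (Fin m) (Fin m) ℍ} (hA : Aᴴ * A = 1) :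
    ∃ (U : Matrix (Fin m) (Fin m) ℍ) (q : Fin m → ℍ),
      Uᴴ * U = 1 ∧ A * U = U * Matrix.diagonal q ∧ ∀ i, ‖q i‖ = 1 := by
  obtain ⟨v, q, hv, hq⟩ := exists_orthonormal_eigenvectors hA m le_rfl
  refine ⟨Matrix.of fun i j => v j i, fun i => (q i).unop, ?_, ?_, ?_⟩
  · ext1 i j
    rw [Matrix.one_apply, ← hv i j, Matrix.mul_apply]
    rfl
  · ext1 i j
    rw [Matrix.mul_diagonal]
    exact congrFun (hq j) i
  · intro i
    have h2 : star (q i • v i) ⬝ᵥ (q i • v i) = 1 := by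
      rw [← hq, star_mulVec_dotProduct_mulVec hA, hv, if_pos rfl]
    rw [star_smul_dotProduct_smul, hv, if_pos rfl, mul_one] at h2
    have h3 := congrArg norm h2
    rw [norm_mul, Quaternion.norm_star, norm_one] at h3
    nlinarith [norm_nonneg (q i).unop]

/-! ### The Hermitian form and the matrices of `Sp(n,1)` -/

theorem herm_apply (z w : Vec n) :
    herm z w = ∑ i, star (w (Sum.inl i)) * z (Sum.inl i) -
      (star (w (Sum.inr 0)) * z (Sum.inr 1) + star (w (Sum.inr 1)) * z (Sum.inr 0)) := by
  rw [herm, dotProduct, Fintype.sum_sum_type, Fin.sum_univ_two]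
  simp only [Matrix.mulVec, dotProduct, Fintype.sum_sum_type, Fin.sum_univ_two, J,
    Matrix.fromBlocks_apply₁₁, Matrix.fromBlocks_apply₁₂, Matrix.fromBlocks_apply₂₁,
    Matrix.fromBlocks_apply₂₂, Matrix.one_apply]
  simp
  abel

theorem J_mul_J : J n * J n = 1 := by
  rw [J, Matrix.fromBlocks_multiply, ← Matrix.fromBlocks_one]
  congr 1 <;> simp [Matrix.one_fin_two]

theorem mat_mul (g h : Sp n) : mat (g * h) = mat g * mat h := rfl

theorem mat_one : mat (1 : Sp n) = 1 := rfl

theorem mat_conjTranspose_mul (g : Sp n) : (mat g)ᴴ * J n * mat g = J n := g.2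

theorem mat_inv (g : Sp n) : mat g⁻¹ = J n * (mat g)ᴴ * J n := by
  have h1 : J n * (mat g)ᴴ * J n * mat g = 1 := by
    have := congrArg (J n * ·) (mat_conjTranspose_mul g)
    simpa only [J_mul_J, Matrix.mul_assoc] using this
  have h2 : mat g * mat g⁻¹ = 1 := congrArg mat (mul_inv_cancel g)
  calc mat g⁻¹ = J n * (mat g)ᴴ * J n * mat g * mat g⁻¹ := by rw [h1, Matrix.one_mul]
    _ = _ := by rw [Matrix.mul_assoc, h2, Matrix.mul_one]

theorem mat_mul_J_mul_conjTranspose (g : Sp n) : mat g * J n * (mat g)ᴴ = J n := by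
  have h2 : mat g * mat g⁻¹ = 1 := congrArg mat (mul_inv_cancel g)
  rw [mat_inv, ← Matrix.mul_assoc, ← Matrix.mul_assoc] at h2
  have := congrArg (· * J n) h2
  simpa only [Matrix.mul_assoc, J_mul_J, Matrix.mul_one, Matrix.one_mul] using this

theorem exists_mat_eq (M : Matrix (Idx n) (Idx n) ℍ) (hM : Mᴴ * J n * M = J n) :
    ∃ g : Sp n, mat g = M := by
  have h1 : J n * Mᴴ * J n * M = 1 := by
    have := congrArg (J n * ·) hM
    simpa only [J_mul_J, Matrix.mul_assoc] using this
  exact ⟨⟨⟨M, J n * Mᴴ * J n, mul_eq_one_comm.mp h1, h1⟩, hM⟩, rfl⟩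

theorem exists_mat_eq_of_herm (M : Matrix (Idx n) (Idx n) ℍ)
    (hM : ∀ i j, herm (fun k => M k j) (fun k => M k i) = J n i j) :
    ∃ g : Sp n, mat g = M := by
  refine exists_mat_eq M ?_
  ext1 i j
  rw [← hM i j, Matrix.mul_assoc]
  rfl

theorem herm_mat (g : Sp n) (z w : Vec n) : herm (mat g *ᵥ z) (mat g *ᵥ w) = herm z w :=
  (mem_Sp_iff_herm g.1).mp g.2 z w

theorem star_herm (z w : Vec n) : star (herm z w) = herm w z := by
  simp only [herm_apply, star_sub, star_add, star_sum, star_mul, star_star]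
  abel

theorem norm_herm_comm (z w : Vec n) : ‖herm z w‖ = ‖herm w z‖ := by
  rw [← star_herm, Quaternion.norm_star]

/-! ### Transitivity on pairs of distinct boundary points -/

/-- The two standard null vectors. -/
def nullVec (n : ℕ) (k : Fin 2) : Vec n := Pi.single (Sum.inr k) 1

theorem nullVec_ne_zero (k : Fin 2) : nullVec n k ≠ 0 := by simp [nullVec]

/-- The two boundary points spanned by the standard null vectors. -/
def nullPt (n : ℕ) (k : Fin 2) : Pt n := Projectivization.mk ℍᵐᵒᵖ _ (nullVec_ne_zero k)

theorem mulVec_nullVec (M : Matrix (Idx n) (Idx n) ℍ) (k : Fin 2) :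
    M *ᵥ nullVec n k = fun i => M i (Sum.inr k) := by
  ext1 i
  simp [nullVec]

theorem herm_nullVec_zero (z : Vec n) : herm z (nullVec n 0) = -z (Sum.inr 1) := by
  simp [herm_apply, nullVec]

theorem herm_nullVec_one (z : Vec n) : herm z (nullVec n 1) = -z (Sum.inr 0) := by
  simp [herm_apply, nullVec]

theorem nullPt_mem_bdry (k : Fin 2) : nullPt n k ∈ bdry n := by
  rw [nullPt, mk_mem_bdry]
  fin_cases k
  · exact (herm_nullVec_zero _).trans (by simp [nullVec])
  · exact (herm_nullVec_one _).trans (by simp [nullVec])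

theorem smul_mem_bdry (g : Sp n) {p : Pt n} (hp : p ∈ bdry n) : g • p ∈ bdry n := by
  induction p using Projectivization.ind with
  | h z hz =>
    obtain ⟨h, e⟩ := smul_mk_eq g z hz
    rw [mk_mem_bdry] at hp
    rwa [e, mk_mem_bdry, herm_mat]

theorem smul_mem_hypSpace (g : Sp n) {p : Pt n} (hp : p ∈ hypSpace n) : g • p ∈ hypSpace n := by
  induction p using Projectivization.ind with
  | h z hz =>
    obtain ⟨h, e⟩ := smul_mk_eq g z hz
    rw [mk_mem_hypSpace] at hp
    rwa [e, mk_mem_hypSpace, herm_mat]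

/-- Heisenberg translations fix one standard boundary point and move the other one to any
prescribed finite boundary point. -/
theorem exists_heisenberg_translation (z : Vec n) (hz : herm z z = 0) (hz1 : z (Sum.inr 1) = 1) :
    ∃ g : Sp n, mat g *ᵥ nullVec n 0 = nullVec n 0 ∧ mat g *ᵥ nullVec n 1 = z := by
  -- The last column is `z`. The `star` entries make the first columns orthogonal to it, and nullity
  -- of `z` is the one remaining Gram relation.
  let M : Matrix (Idx n) (Idx n) ℍ := Matrix.fromBlocks 1
    (Matrix.of fun i k => if k = 1 then z (Sum.inl i) else 0)
    (Matrix.of fun k i => if k = 0 then star (z (Sum.inl i)) else 0)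
    !![1, z (Sum.inr 0); 0, 1]
  have hM1 : (fun k => M k (Sum.inr 1)) = z := by
    ext1 k
    rcases k with k | k
    · simp [M]
    · fin_cases k <;> simp [M, hz1]
  obtain ⟨g, hg⟩ := exists_mat_eq_of_herm M (by
    intro i j
    have h11 : herm (fun k => M k (Sum.inr 1)) (fun k => M k (Sum.inr 1)) = 0 := by
      rw [hM1, hz]
    rcases i with i | i
    · rcases j with j | j
      · rcases eq_or_ne i j with rfl | hij
        · simp [herm_apply, M, J, Matrix.one_apply, apply_ite star]
        · simp [herm_apply, M, J, Matrix.one_apply, apply_ite star, hij, hij.symm]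
      · fin_cases j <;> simp [herm_apply, M, J, Matrix.one_apply, apply_ite star]
    · rcases j with j | j
      · fin_cases i <;> simp [herm_apply, M, J, Matrix.one_apply]
      · fin_cases i <;> fin_cases j
        · simp [herm_apply, M, J]
        · simp [herm_apply, M, J]
        · simp [herm_apply, M, J]
        · exact h11.trans (by simp [J]))
  refine ⟨g, ?_, ?_⟩
  · rw [mulVec_nullVec, hg]
    ext1 k
    rcases k with k | k
    · simp [M, nullVec]
    · fin_cases k <;> simp [M, nullVec]
  · rw [mulVec_nullVec, hg, hM1]

theorem exists_swap : ∃ g : Sp n, mat g *ᵥ nullVec n 0 = nullVec n 1 := by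
  let M : Matrix (Idx n) (Idx n) ℍ := Matrix.fromBlocks 1 0 0 !![0, 1; 1, 0]
  obtain ⟨g, hg⟩ := exists_mat_eq_of_herm M (by
    intro i j
    rcases i with i | i <;> rcases j with j | j
    · rcases eq_or_ne i j with rfl | hij
      · simp [herm_apply, M, J, Matrix.one_apply, apply_ite star]
      · simp [herm_apply, M, J, Matrix.one_apply, apply_ite star, hij, hij.symm]
    · fin_cases j <;> simp [herm_apply, M, J, Matrix.one_apply]
    · fin_cases i <;> simp [herm_apply, M, J, Matrix.one_apply]
    · fin_cases i <;> fin_cases j <;> simp [herm_apply, M, J])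
  refine ⟨g, ?_⟩
  rw [mulVec_nullVec, hg]
  ext1 k
  rcases k with k | k
  · simp [M, nullVec]
  · fin_cases k <;> simp [M, nullVec]

theorem smul_mk_eq_of_mulVec {g : Sp n} {z w : Vec n} (hz : z ≠ 0) (hw : w ≠ 0)
    (h : mat g *ᵥ z = w) :
    g • (Projectivization.mk ℍᵐᵒᵖ z hz : Pt n) = Projectivization.mk ℍᵐᵒᵖ w hw := by
  subst h
  exact (smul_mk_eq g z hz).choose_spec

theorem exists_smul_of_smul_mk_eq {g : Sp n} {z w : Vec n} (hz : z ≠ 0) (hw : w ≠ 0)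
    (h : g • (Projectivization.mk ℍᵐᵒᵖ z hz : Pt n) = Projectivization.mk ℍᵐᵒᵖ w hw) :
    ∃ q : ℍᵐᵒᵖ, mat g *ᵥ z = q • w := by
  obtain ⟨h1, h2⟩ := smul_mk_eq g z hz
  rw [h2, Projectivization.mk_eq_mk_iff'] at h
  obtain ⟨q, hq⟩ := h
  exact ⟨q, hq.symm⟩

/-- A null vector orthogonal to a standard null vector is proportional to it. -/
theorem eq_smul_nullVec_of_herm_self_eq_zero {z : Vec n} (hz : herm z z = 0) {k l : Fin 2} (hkl : k ≠ l)
    (h : z (Sum.inr k) = 0) : z = MulOpposite.op (z (Sum.inr l)) • nullVec n l := by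
  have h0 : ∑ i, ‖z (Sum.inl i)‖ ^ 2 = 0 := by
    have h1 := star_dotProduct_self (fun i => z (Sum.inl i))
    have h2 : star (z (Sum.inr 0)) * z (Sum.inr 1) + star (z (Sum.inr 1)) * z (Sum.inr 0) = 0 := by
      fin_cases k <;> fin_cases l <;> simp_all
    rw [herm_apply, h2, sub_zero] at hz
    exact Quaternion.coe_injective ((h1.symm.trans hz).trans Quaternion.coe_zero.symm)
  rw [Finset.sum_eq_zero_iff_of_nonneg (fun _ _ => by positivity)] at h0
  ext1 i
  rcases i with i | i
  · have := h0 i (Finset.mem_univ i)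
    simpa [nullVec] using this
  · fin_cases k <;> fin_cases l <;> fin_cases i <;> simp_all [nullVec]

theorem exists_smul_nullPt_one_eq {p : Pt n} (hp : p ∈ bdry n) (hp0 : p ≠ nullPt n 0) :
    ∃ g : Sp n, g • nullPt n 0 = nullPt n 0 ∧ g • nullPt n 1 = p := by
  induction p using Projectivization.ind with
  | h z hz =>
    rw [mk_mem_bdry] at hp
    have h1 : z (Sum.inr 1) ≠ 0 := by
      intro h
      apply hp0
      rw [nullPt, Projectivization.mk_eq_mk_iff']
      exact ⟨_, (eq_smul_nullVec_of_herm_self_eq_zero hp (by decide : (1 : Fin 2) ≠ 0) h).symm⟩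
    set q : ℍᵐᵒᵖ := MulOpposite.op (z (Sum.inr 1))⁻¹
    obtain ⟨g, hg0, hg1⟩ := exists_heisenberg_translation (q • z)
      (by rw [herm_smul_smul, hp]; simp) (by simp [q, h1])
    refine ⟨g, smul_mk_eq_of_mulVec _ _ hg0, ?_⟩
    have hq : q • z ≠ 0 := smul_ne_zero (by simpa [q] using h1) hz
    rw [nullPt, smul_mk_eq_of_mulVec _ hq hg1, Projectivization.mk_eq_mk_iff']
    exact ⟨q, rfl⟩

/-- `Sp(n,1)` acts transitively on pairs of distinct boundary points. -/
theorem exists_smul_eq_nullPt {u v : Pt n} (hu : u ∈ bdry n) (hv : v ∈ bdry n) (huv : u ≠ v) :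
    ∃ f : Sp n, f • u = nullPt n 0 ∧ f • v = nullPt n 1 := by
  obtain ⟨f₁, hf₁⟩ : ∃ f₁ : Sp n, f₁ • u = nullPt n 0 := by
    by_cases h : u = nullPt n 0
    · exact ⟨1, by rw [one_smul, h]⟩
    · obtain ⟨g, -, hg⟩ := exists_smul_nullPt_one_eq hu h
      obtain ⟨s, hs⟩ := exists_swap (n := n)
      refine ⟨(g * s)⁻¹, ?_⟩
      rw [inv_smul_eq_iff, mul_smul, ← hg]
      congr 1
      exact (smul_mk_eq_of_mulVec _ _ hs).symm
  obtain ⟨g, hg0, hg1⟩ := exists_smul_nullPt_one_eq (smul_mem_bdry f₁ hv)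
    (fun h => huv (smul_left_cancel f₁ (hf₁.trans h.symm)))
  refine ⟨g⁻¹ * f₁, ?_, ?_⟩
  · rw [mul_smul, hf₁, inv_smul_eq_iff, hg0]
  · rw [mul_smul, inv_smul_eq_iff, hg1]

/-! ### Elements fixing or exchanging two boundary points -/

theorem herm_nullVec_one_zero : herm (nullVec n 1) (nullVec n 0) = -1 := by
  rw [herm_nullVec_zero]; simp [nullVec]

theorem herm_nullVec_zero_one : herm (nullVec n 0) (nullVec n 1) = -1 := by
  rw [herm_nullVec_one]; simp [nullVec]

theorem herm_nullVec_self (k : Fin 2) : herm (nullVec n k) (nullVec n k) = 0 :=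
  (mk_mem_bdry _ (nullVec_ne_zero k)).mp (nullPt_mem_bdry k)

theorem herm_combination (r s : ℍᵐᵒᵖ) :
    herm (r • nullVec n 0 + s • nullVec n 1) (r • nullVec n 0 + s • nullVec n 1) =
      -(star r.unop * s.unop + star s.unop * r.unop) := by
  simp [herm_apply, nullVec]

theorem smul_nullVec_ne_zero (r s : ℍᵐᵒᵖ) (hs : s ≠ 0) :
    r • nullVec n 0 + s • nullVec n 1 ≠ 0 := by
  intro h
  have := congrFun h (Sum.inr 1)
  simp [nullVec] at this
  exact hs this

theorem exists_fixed_mem_hypSpace {g : Sp n} {r s q : ℍᵐᵒᵖ} (hs : s ≠ 0)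
    (h : mat g *ᵥ (r • nullVec n 0 + s • nullVec n 1) = q • (r • nullVec n 0 + s • nullVec n 1))
    (hneg : 0 < (star r.unop * s.unop + star s.unop * r.unop).re) :
    ∃ p ∈ hypSpace n, g • p = p := by
  have hz := smul_nullVec_ne_zero (n := n) r s hs
  refine ⟨Projectivization.mk _ _ hz, ?_, ?_⟩
  · rw [mk_mem_hypSpace, herm_combination, Quaternion.re_neg]
    linarith
  · have hq : q • (r • nullVec n 0 + s • nullVec n 1) ≠ 0 := by
      rw [← h]
      exact (smul_mk_eq g _ hz).choose
    rw [smul_mk_eq_of_mulVec hz hq h, Projectivization.mk_eq_mk_iff']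
    exact ⟨q, rfl⟩

theorem exists_fixed_mem_hypSpace_of_conj {g f : Sp n}
    (h : ∃ p ∈ hypSpace n, (f * g * f⁻¹) • p = p) : ∃ p ∈ hypSpace n, g • p = p := by
  obtain ⟨p, hp, e⟩ := h
  refine ⟨f⁻¹ • p, smul_mem_hypSpace _ hp, ?_⟩
  rw [mul_smul, mul_smul] at e
  rw [eq_inv_smul_iff, e]

/-- An element exchanging two boundary points fixes a point of hyperbolic space. -/
theorem exists_fixed_mem_hypSpace_of_exchange {g : Sp n} {u v : Pt n} (hu : u ∈ bdry n)
    (hv : v ∈ bdry n) (huv : u ≠ v) (h1 : g • u = v) (h2 : g • v = u) :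
    ∃ p ∈ hypSpace n, g • p = p := by
  obtain ⟨f, hf0, hf1⟩ := exists_smul_eq_nullPt hu hv huv
  apply exists_fixed_mem_hypSpace_of_conj (f := f)
  have e0 : (f * g * f⁻¹) • nullPt n 0 = nullPt n 1 := by
    rw [← hf0, ← hf1, mul_smul, mul_smul, inv_smul_smul, h1]
  have e1 : (f * g * f⁻¹) • nullPt n 1 = nullPt n 0 := by
    rw [← hf0, ← hf1, mul_smul, mul_smul, inv_smul_smul, h2]
  generalize f * g * f⁻¹ = a at e0 e1
  obtain ⟨c, hc⟩ := exists_smul_of_smul_mk_eq _ _ e0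
  obtain ⟨b, hb⟩ := exists_smul_of_smul_mk_eq _ _ e1
  have hcb : star c.unop * b.unop = 1 := by
    have := herm_mat a (nullVec n 1) (nullVec n 0)
    rw [hc, hb, herm_smul_smul, herm_nullVec_zero_one, herm_nullVec_one_zero] at this
    simpa using this
  have hb0 : b.unop ≠ 0 := by
    intro h
    rw [h, mul_zero] at hcb
    exact zero_ne_one hcb
  set r : ℝ := ‖b.unop‖ with hr
  have hr0 : 0 < r := norm_pos_iff.mpr hb0
  have hrr : ((r : ℝ) : ℍ) * ((r⁻¹ : ℝ) : ℍ) = 1 := by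
    rw [← Quaternion.coe_mul, mul_inv_cancel₀ hr0.ne', Quaternion.coe_one]
  -- `star c * b = 1` means `c = b / |b|²`. With `r = |b|`, the vector `e₀ r + e₁` is then an
  -- eigenvector with right eigenvalue `r⁻¹ b`, and its norm `-2r` is negative.
  have hcr : c.unop * ((r : ℝ) : ℍ) * ((r : ℝ) : ℍ) = b.unop := by
    have h3 : b.unop * star b.unop = ((r * r : ℝ) : ℍ) := by
      rw [Quaternion.self_mul_star, Quaternion.normSq_eq_norm_mul_self]
    have h4 : star b.unop * c.unop = 1 := by
      have := congrArg star hcb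
      simpa using this
    calc _ = c.unop * ((r * r : ℝ) : ℍ) := by rw [mul_assoc, ← Quaternion.coe_mul]
      _ = ((r * r : ℝ) : ℍ) * c.unop := (Quaternion.coe_commutes _ _).symm
      _ = b.unop * (star b.unop * c.unop) := by rw [← h3, mul_assoc]
      _ = b.unop := by rw [h4, mul_one]
  refine exists_fixed_mem_hypSpace (r := MulOpposite.op ((r : ℝ) : ℍ)) (s := 1)
    (q := MulOpposite.op (((r⁻¹ : ℝ) : ℍ) * b.unop)) one_ne_zero ?_ ?_
  · rw [Matrix.mulVec_add, Matrix.mulVec_smul, one_smul, hc, hb, smul_add, smul_smul,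
      smul_smul, add_comm]
    congr 2
    · apply MulOpposite.unop_injective
      simp only [MulOpposite.unop_mul, MulOpposite.unop_op]
      rw [← mul_assoc, hrr, one_mul]
    · apply MulOpposite.unop_injective
      simp only [MulOpposite.unop_mul, MulOpposite.unop_op]
      rw [← hcr, Quaternion.coe_commutes, mul_assoc, hrr, mul_one]
  · simp
    linarith

/-- An isometry fixing the line of a null vector preserves the orthogonal complement of that line.
-/
theorem apply_inr_one_inl_eq_zero {g : Sp n} {q : ℍᵐᵒᵖ}
    (hg : mat g *ᵥ nullVec n 0 = q • nullVec n 0)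
    (hq : q ≠ 0) (i : Fin (n - 1)) : mat g (Sum.inr 1) (Sum.inl i) = 0 := by
  have h := herm_mat g (Pi.single (Sum.inl i) 1) (nullVec n 0)
  rw [hg, ← one_smul ℍᵐᵒᵖ (mat g *ᵥ _), herm_smul_smul, herm_nullVec_zero, herm_nullVec_zero] at h
  simpa [hq] using h

theorem apply_inr_zero_inl_eq_zero {g : Sp n} {q : ℍᵐᵒᵖ}
    (hg : mat g *ᵥ nullVec n 1 = q • nullVec n 1)
    (hq : q ≠ 0) (i : Fin (n - 1)) : mat g (Sum.inr 0) (Sum.inl i) = 0 := by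
  have h := herm_mat g (Pi.single (Sum.inl i) 1) (nullVec n 1)
  rw [hg, ← one_smul ℍᵐᵒᵖ (mat g *ᵥ _), herm_smul_smul, herm_nullVec_one, herm_nullVec_one] at h
  simpa [hq] using h

/-! ### Diagonal form of a loxodromic element -/

theorem ne_of_fixedPts_eq {g : Sp n} {u v : Pt n} (hg : IsLoxodromic g)
    (huv : fixedPts g = {u, v}) : u ≠ v := by
  rintro rfl
  have := hg.2.1
  rw [huv] at this
  simp at this

theorem not_fixed_mem_hypSpace {g : Sp n} (hg : IsLoxodromic g) :
    ¬ ∃ p ∈ hypSpace n, g • p = p := by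
  rintro ⟨p, hp, e⟩
  have h : herm p.rep p.rep = 0 := hg.2.2 ⟨Or.inl hp, e⟩
  have h' : (herm p.rep p.rep).re < 0 := hp
  rw [h] at h'
  exact lt_irrefl _ h'

/-- A loxodromic element is conjugate to a diagonal matrix; the conjugating element may be chosen
to move the fixed points to the standard boundary points. -/
theorem exists_isDiagForm {g : Sp n} {u v : Pt n} (hg : IsLoxodromic g)
    (huv : fixedPts g = {u, v}) :
    ∃ (f : Sp n) (lam : Idx n → ℍ), f • u = nullPt n 0 ∧ f • v = nullPt n 1 ∧
      mat (f * g * f⁻¹) = Matrix.diagonal lam ∧ IsDiagForm g lam := by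
  have hu : u ∈ fixedPts g := by rw [huv]; simp
  have hv : v ∈ fixedPts g := by rw [huv]; simp
  obtain ⟨f₀, hf0, hf1⟩ := exists_smul_eq_nullPt (hg.2.2 hu) (hg.2.2 hv) (ne_of_fixedPts_eq hg huv)
  have e0 : (f₀ * g * f₀⁻¹) • nullPt n 0 = nullPt n 0 := by
    rw [← hf0, mul_smul, mul_smul, inv_smul_smul, hu.2]
  have e1 : (f₀ * g * f₀⁻¹) • nullPt n 1 = nullPt n 1 := by
    rw [← hf1, mul_smul, mul_smul, inv_smul_smul, hv.2]
  have hfix : ¬ ∃ p ∈ hypSpace n, (f₀ * g * f₀⁻¹) • p = p := fun h =>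
    not_fixed_mem_hypSpace hg (exists_fixed_mem_hypSpace_of_conj h)
  set g₀ := f₀ * g * f₀⁻¹ with hg₀
  obtain ⟨a, ha⟩ := exists_smul_of_smul_mk_eq _ _ e0
  obtain ⟨b, hb⟩ := exists_smul_of_smul_mk_eq _ _ e1
  have hab : star a.unop * b.unop = 1 := by
    have := herm_mat g₀ (nullVec n 1) (nullVec n 0)
    rw [ha, hb, herm_smul_smul, herm_nullVec_one_zero] at this
    simpa using this
  have ha0 : a ≠ 0 := by rintro rfl; simp at hab
  have hb0 : b ≠ 0 := by rintro rfl; simp at hab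
  -- If `|a| = 1`, then `star a * b = 1` forces `b = a`, and the negative vector `e₀ + e₁` spans a
  -- fixed line.
  have hnorm : ‖a.unop‖ ≠ 1 := by
    intro h
    have hba : b = a := by
      apply MulOpposite.unop_injective
      have h3 : a.unop * star a.unop = 1 := by
        rw [Quaternion.self_mul_star, Quaternion.normSq_eq_norm_mul_self, h, mul_one,
          Quaternion.coe_one]
      calc b.unop = a.unop * star a.unop * b.unop := by rw [h3, one_mul]
        _ = a.unop := by rw [mul_assoc, hab, mul_one]
    refine hfix (exists_fixed_mem_hypSpace (r := 1) (s := 1) (q := a) one_ne_zero ?_ ?_)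
    · rw [one_smul, one_smul, Matrix.mulVec_add, ha, hb, hba, smul_add]
    · simp
  have hcol : ∀ i, mat g₀ i (Sum.inr 0) = (a • nullVec n 0) i := fun i => by
    rw [← ha, mulVec_nullVec]
  have hcol' : ∀ i, mat g₀ i (Sum.inr 1) = (b • nullVec n 1) i := fun i => by
    rw [← hb, mulVec_nullVec]
  have hr1 := apply_inr_one_inl_eq_zero ha ha0
  have hr0 := apply_inr_zero_inl_eq_zero hb hb0
  set A : Matrix (Fin (n - 1)) (Fin (n - 1)) ℍ := (mat g₀).toBlocks₁₁ with hA
  -- On the first `n - 1` coordinates the form is the standard positive definite one, so the block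
  -- is unitary.
  have hAu : Aᴴ * A = 1 := by
    ext1 i j
    have h := herm_mat g₀ (Pi.single (Sum.inl j) 1) (Pi.single (Sum.inl i) 1)
    rw [herm_apply, herm_apply] at h
    simp only [Matrix.mulVec_single_one, Matrix.col_apply, hr0, hr1] at h
    rw [Matrix.mul_apply]
    simpa [Pi.single_apply, Matrix.one_apply, A, Matrix.toBlocks₁₁, apply_ite star,
      @eq_comm _ j i] using h
  obtain ⟨U, q, hU, hAU, hq⟩ := exists_unitary_diagonalization hAu
  have hmat : mat g₀ = Matrix.fromBlocks A 0 0 (Matrix.diagonal ![a.unop, b.unop]) := by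
    ext1 i j
    rcases i with i | i <;> rcases j with j | j
    · rfl
    · fin_cases j
      · simp [hcol, nullVec]
      · simp [hcol', nullVec]
    · fin_cases i
      · simp [hr0]
      · simp [hr1]
    · fin_cases i <;> fin_cases j
      · simp [hcol, nullVec]
      · simp [hcol', nullVec]
      · simp [hcol, nullVec]
      · simp [hcol', nullVec]
  obtain ⟨s, hs⟩ := exists_mat_eq (Matrix.fromBlocks U 0 0 1 : Matrix (Idx n) (Idx n) ℍ) (by
    simp [J, Matrix.fromBlocks_conjTranspose, Matrix.fromBlocks_multiply, hU])
  set lam : Idx n → ℍ := Sum.elim q ![a.unop, b.unop] with hlam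
  have hdiag : mat g₀ * mat s = mat s * Matrix.diagonal lam := by
    rw [hmat, hs, hlam, ← Matrix.fromBlocks_diagonal, Matrix.fromBlocks_multiply,
      Matrix.fromBlocks_multiply]
    simp [hAU]
  have hd : mat (s⁻¹ * f₀ * g * (s⁻¹ * f₀)⁻¹) = Matrix.diagonal lam := by
    rw [show s⁻¹ * f₀ * g * (s⁻¹ * f₀)⁻¹ = s⁻¹ * (g₀ * s) by rw [hg₀]; group, mat_mul, mat_mul,
      hdiag, ← Matrix.mul_assoc, ← mat_mul, inv_mul_cancel, mat_one, Matrix.one_mul]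
  have hsfix : ∀ k, s • nullPt n k = nullPt n k := by
    intro k
    refine smul_mk_eq_of_mulVec _ _ ?_
    rw [mulVec_nullVec, hs]
    ext1 i
    rcases i with i | i
    · simp [nullVec]
    · simp [nullVec, Matrix.one_apply, Pi.single_apply]
  refine ⟨s⁻¹ * f₀, lam, ?_, ?_, hd, ⟨_, hd⟩, hq, hnorm, hab⟩
  · rw [mul_smul, hf0, inv_smul_eq_iff, hsfix]
  · rw [mul_smul, hf1, inv_smul_eq_iff, hsfix]

/-! ### Ptolemy's inequality for null vectors -/

/-- Cauchy–Schwarz. The factor `2` in the hypotheses is the one produced by null vectors and null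
rows. -/
theorem norm_sum_mul_mul_le {ι : Type*} [Fintype ι] {x y w : ι → ℍ} {C s t : ℝ} (hC : 0 ≤ C)
    (hw : ∀ i, ‖w i‖ ≤ C) (hx : ∑ i, ‖x i‖ ^ 2 ≤ 2 * s)
    (hy : ∑ i, ‖y i‖ ^ 2 ≤ 2 * t) :
    ‖∑ i, x i * w i * star (y i)‖ ≤ C * (2 * (√s * √t)) := by
  calc ‖∑ i, x i * w i * star (y i)‖ ≤ ∑ i, ‖x i * w i * star (y i)‖ := norm_sum_le _ _
    _ ≤ ∑ i, C * (‖x i‖ * ‖y i‖) := by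
        refine Finset.sum_le_sum fun i _ => ?_
        rw [norm_mul, norm_mul, Quaternion.norm_star]
        nlinarith [mul_le_mul_of_nonneg_right (hw i)
          (mul_nonneg (norm_nonneg (x i)) (norm_nonneg (y i)))]
    _ = C * ∑ i, ‖x i‖ * ‖y i‖ := by rw [Finset.mul_sum]
    _ ≤ C * (√(∑ i, ‖x i‖ ^ 2) * √(∑ i, ‖y i‖ ^ 2)) := by
        gcongr
        exact Real.sum_mul_le_sqrt_mul_sqrt _ _ _
    _ ≤ C * (√(2 * s) * √(2 * t)) := by gcongr
    _ = C * (2 * (√s * √t)) := by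
        rw [Real.sqrt_mul zero_le_two, Real.sqrt_mul zero_le_two]
        linear_combination C * √s * √t * Real.mul_self_sqrt (zero_le_two (α := ℝ))

theorem sum_norm_sq_le_of_null {z : Vec n} (hz : herm z z = 0) :
    ∑ i, ‖z (Sum.inl i)‖ ^ 2 ≤ 2 * (‖z (Sum.inr 0)‖ * ‖z (Sum.inr 1)‖) := by
  have h1 := star_dotProduct_self (fun i => z (Sum.inl i))
  rw [herm_apply, sub_eq_zero] at hz
  have h2 := congrArg norm (h1.symm.trans hz)
  rw [Quaternion.norm_coe, Real.norm_of_nonneg (Finset.sum_nonneg fun _ _ => by positivity)] at h2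
  rw [h2]
  refine (norm_add_le _ _).trans ?_
  rw [norm_mul, norm_mul, Quaternion.norm_star, Quaternion.norm_star]
  linarith

/-- Cauchy–Schwarz bounds the contribution of the first coordinates by exactly the cross term of the
square; the last two coordinates give the two squares. This is Ptolemy's inequality when the other
two points are the standard ones. -/
theorem norm_herm_le_of_null {p r : Vec n} (hp : herm p p = 0) (hr : herm r r = 0) :
    ‖herm p r‖ ≤ (√(‖p (Sum.inr 0)‖ * ‖r (Sum.inr 1)‖) +
      √(‖p (Sum.inr 1)‖ * ‖r (Sum.inr 0)‖)) ^ 2 := by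
  have h := norm_sum_mul_mul_le (x := fun i => star (r (Sum.inl i))) (w := fun _ => 1)
    (y := fun i => star (p (Sum.inl i))) (C := 1) zero_le_one
    (fun _ => norm_one.le) (by simpa using sum_norm_sq_le_of_null hr)
    (by simpa using sum_norm_sq_le_of_null hp)
  simp only [mul_one, star_star, one_mul] at h
  rw [herm_apply]
  have hs : √(‖r (Sum.inr 0)‖ * ‖r (Sum.inr 1)‖) * √(‖p (Sum.inr 0)‖ * ‖p (Sum.inr 1)‖) =
      √(‖p (Sum.inr 0)‖ * ‖r (Sum.inr 1)‖) * √(‖p (Sum.inr 1)‖ * ‖r (Sum.inr 0)‖) := by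
    rw [← Real.sqrt_mul (by positivity), ← Real.sqrt_mul (by positivity)]
    congr 1
    ring
  rw [hs] at h
  calc _ ≤ _ := norm_sub_le _ _
    _ ≤ _ := add_le_add h (norm_add_le _ _)
    _ = _ := by
      rw [norm_mul, norm_mul, Quaternion.norm_star, Quaternion.norm_star, add_sq,
        Real.sq_sqrt (by positivity), Real.sq_sqrt (by positivity)]
      ring

/-- Ptolemy's inequality for four null vectors. -/
theorem sqrt_norm_herm_mul_le {p q r s : Vec n} (hp : herm p p = 0) (hq : herm q q = 0)
    (hr : herm r r = 0) (hs : herm s s = 0) :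
    √(‖herm p r‖ * ‖herm q s‖) ≤
      √(‖herm p q‖ * ‖herm r s‖) + √(‖herm p s‖ * ‖herm q r‖) := by
  by_cases hqs : herm q s = 0
  · rw [hqs, norm_zero, mul_zero, Real.sqrt_zero]
    positivity
  have hq0 : q ≠ 0 := by rintro rfl; simp [herm_apply] at hqs
  have hs0 : s ≠ 0 := by rintro rfl; simp [herm_apply] at hqs
  have hne : (Projectivization.mk ℍᵐᵒᵖ q hq0 : Pt n) ≠ Projectivization.mk ℍᵐᵒᵖ s hs0 := by
    rw [Ne, Projectivization.mk_eq_mk_iff']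
    rintro ⟨c, rfl⟩
    apply hqs
    have := herm_smul_smul c 1 s s
    rw [one_smul, hs] at this
    simpa using this
  -- All terms are invariant under `Sp(n,1)`, so `q` and `s` may be moved to multiples of the
  -- standard null vectors.
  obtain ⟨f, hf0, hf1⟩ := exists_smul_eq_nullPt ((mk_mem_bdry q hq0).mpr hq)
    ((mk_mem_bdry s hs0).mpr hs) hne
  obtain ⟨a, ha⟩ := exists_smul_of_smul_mk_eq _ _ hf0
  obtain ⟨b, hb⟩ := exists_smul_of_smul_mk_eq _ _ hf1
  rw [← herm_mat f p r, ← herm_mat f q s, ← herm_mat f p q, ← herm_mat f r s, ← herm_mat f p s,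
    ← herm_mat f q r, ha, hb]
  rw [← herm_mat f p p] at hp
  rw [← herm_mat f r r] at hr
  generalize mat f *ᵥ p = P at *
  generalize mat f *ᵥ r = R at *
  have h0 : ∀ z : Vec n, ‖herm z (a • nullVec n 0)‖ = ‖a.unop‖ * ‖z (Sum.inr 1)‖ := fun z => by
    rw [← one_smul ℍᵐᵒᵖ z, herm_smul_smul, herm_nullVec_zero]
    simp
  have h1 : ∀ z : Vec n, ‖herm z (b • nullVec n 1)‖ = ‖b.unop‖ * ‖z (Sum.inr 0)‖ := fun z => by
    rw [← one_smul ℍᵐᵒᵖ z, herm_smul_smul, herm_nullVec_one]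
    simp
  rw [norm_herm_comm (a • nullVec n 0) R, h0, h0, h1, h1, h1]
  have e : ‖(a • nullVec n 0) (Sum.inr 0)‖ = ‖a.unop‖ := by simp [nullVec]
  rw [e]
  apply Real.sqrt_le_iff.mpr
  refine ⟨by positivity, ?_⟩
  set k := ‖a.unop‖ * ‖b.unop‖ with hk
  have hk0 : 0 ≤ k := by positivity
  have e1 : ‖a.unop‖ * ‖P (Sum.inr 1)‖ * (‖b.unop‖ * ‖R (Sum.inr 0)‖) =
    k * (‖P (Sum.inr 1)‖ * ‖R (Sum.inr 0)‖) := by rw [hk]; ring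
  have e2 : ‖b.unop‖ * ‖P (Sum.inr 0)‖ * (‖a.unop‖ * ‖R (Sum.inr 1)‖) =
    k * (‖P (Sum.inr 0)‖ * ‖R (Sum.inr 1)‖) := by rw [hk]; ring
  rw [e1, e2, Real.sqrt_mul hk0, Real.sqrt_mul hk0, ← mul_add, mul_pow, Real.sq_sqrt hk0,
    mul_comm ‖b.unop‖, ← hk, mul_comm _ k, add_comm]
  exact mul_le_mul_of_nonneg_left (norm_herm_le_of_null hp hr) hk0

/-! ### Corner entries: triangle inequalities and bounds -/

theorem herm_mat_nullVec_self (h : Sp n) (k : Fin 2) :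
    herm (mat h *ᵥ nullVec n k) (mat h *ᵥ nullVec n k) = 0 := by
  rw [herm_mat, herm_nullVec_self]

theorem norm_herm_nullVec_zero_mat (h : Sp n) (k : Fin 2) :
    ‖herm (nullVec n 0) (mat h *ᵥ nullVec n k)‖ = ‖mat h (Sum.inr 1) (Sum.inr k)‖ := by
  rw [norm_herm_comm, herm_nullVec_zero, norm_neg, mulVec_nullVec]

theorem norm_herm_nullVec_one_mat (h : Sp n) (k : Fin 2) :
    ‖herm (nullVec n 1) (mat h *ᵥ nullVec n k)‖ = ‖mat h (Sum.inr 0) (Sum.inr k)‖ := by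
  rw [norm_herm_comm, herm_nullVec_one, norm_neg, mulVec_nullVec]

/-- `|ad|^{1/2}` for the corner entries `a, b, c, d` of `h`. -/
def diagCorner (h : Sp n) : ℝ :=
  √(‖mat h (Sum.inr 0) (Sum.inr 0)‖ * ‖mat h (Sum.inr 1) (Sum.inr 1)‖)

/-- `|bc|^{1/2}` for the corner entries `a, b, c, d` of `h`. -/
def offCorner (h : Sp n) : ℝ :=
  √(‖mat h (Sum.inr 0) (Sum.inr 1)‖ * ‖mat h (Sum.inr 1) (Sum.inr 0)‖)

theorem diagCorner_nonneg (h : Sp n) : 0 ≤ diagCorner h := Real.sqrt_nonneg _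

theorem offCorner_nonneg (h : Sp n) : 0 ≤ offCorner h := Real.sqrt_nonneg _

/-- Ptolemy's inequality for `e₀, e₁, h e₀, h e₁`: the three products over opposite pairs are `1`,
`|ad|`, `|bc|`. The next two lemmas are the other orderings. -/
theorem one_le_diagCorner_add_offCorner (h : Sp n) : 1 ≤ diagCorner h + offCorner h := by
  have := sqrt_norm_herm_mul_le (herm_nullVec_self (n := n) 0) (herm_mat_nullVec_self h 1)
    (herm_nullVec_self 1) (herm_mat_nullVec_self h 0)
  rw [herm_mat, norm_herm_comm (mat h *ᵥ nullVec n 1), norm_herm_nullVec_zero_mat,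
    norm_herm_nullVec_one_mat, norm_herm_nullVec_zero_mat, norm_herm_nullVec_one_mat,
    herm_nullVec_zero_one, herm_nullVec_one_zero] at this
  rw [diagCorner, offCorner, mul_comm ‖mat h (Sum.inr 0) (Sum.inr 0)‖,
    mul_comm ‖mat h (Sum.inr 0) (Sum.inr 1)‖]
  simpa using this

theorem diagCorner_le (h : Sp n) : diagCorner h ≤ 1 + offCorner h := by
  have := sqrt_norm_herm_mul_le (herm_nullVec_self (n := n) 0) (herm_nullVec_self (n := n) 1)
    (herm_mat_nullVec_self h 1) (herm_mat_nullVec_self h 0)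
  rw [herm_mat, norm_herm_nullVec_zero_mat, norm_herm_nullVec_one_mat, norm_herm_nullVec_zero_mat,
    norm_herm_nullVec_one_mat, herm_nullVec_zero_one, herm_nullVec_one_zero] at this
  rw [diagCorner, offCorner, mul_comm ‖mat h (Sum.inr 0) (Sum.inr 0)‖,
    mul_comm ‖mat h (Sum.inr 0) (Sum.inr 1)‖]
  simpa using this

theorem offCorner_le (h : Sp n) : offCorner h ≤ 1 + diagCorner h := by
  have := sqrt_norm_herm_mul_le (herm_nullVec_self (n := n) 0) (herm_nullVec_self (n := n) 1)
    (herm_mat_nullVec_self h 0) (herm_mat_nullVec_self h 1)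
  rw [herm_mat, norm_herm_nullVec_zero_mat, norm_herm_nullVec_one_mat, norm_herm_nullVec_zero_mat,
    norm_herm_nullVec_one_mat, herm_nullVec_zero_one] at this
  rw [diagCorner, offCorner, mul_comm ‖mat h (Sum.inr 0) (Sum.inr 0)‖,
    mul_comm ‖mat h (Sum.inr 0) (Sum.inr 1)‖]
  simpa using this

theorem mul_J_apply_inl (P : Matrix (Idx n) (Idx n) ℍ) (i : Idx n) (j : Fin (n - 1)) :
    (P * J n) i (Sum.inl j) = P i (Sum.inl j) := by
  rw [Matrix.mul_apply, Fintype.sum_sum_type, Fin.sum_univ_two]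
  simp [J, Matrix.one_apply]

theorem mul_J_apply_inr (P : Matrix (Idx n) (Idx n) ℍ) (i : Idx n) :
    (P * J n) i (Sum.inr 0) = -P i (Sum.inr 1) ∧ (P * J n) i (Sum.inr 1) = -P i (Sum.inr 0) := by
  constructor <;>
  · rw [Matrix.mul_apply, Fintype.sum_sum_type, Fin.sum_univ_two]
    simp [J]

theorem mul_diagonal_mul_J_mul_apply (H : Matrix (Idx n) (Idx n) ℍ) (l : Idx n → ℍ) (i j : Idx n) :
    (H * Matrix.diagonal l * J n * Hᴴ) i j =
      ∑ k, H i (Sum.inl k) * l (Sum.inl k) * star (H j (Sum.inl k)) -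
        (H i (Sum.inr 0) * l (Sum.inr 0) * star (H j (Sum.inr 1)) +
          H i (Sum.inr 1) * l (Sum.inr 1) * star (H j (Sum.inr 0))) := by
  rw [Matrix.mul_apply, Fintype.sum_sum_type, Fin.sum_univ_two]
  simp only [Matrix.conjTranspose_apply, mul_J_apply_inl, (mul_J_apply_inr _ _).1,
    (mul_J_apply_inr _ _).2, Matrix.mul_diagonal, neg_mul]
  abel

/-- The entries of `h J h* = J`. This is the case `l = 1` of the expansion of `h diag(l) J h*`;
subtracting it turns each `l i` into `l i - 1`. -/
theorem row_relation (h : Sp n) (i j : Idx n) :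
    ∑ k, mat h i (Sum.inl k) * star (mat h j (Sum.inl k)) -
      (mat h i (Sum.inr 0) * star (mat h j (Sum.inr 1)) +
        mat h i (Sum.inr 1) * star (mat h j (Sum.inr 0))) = J n i j := by
  rw [← mat_mul_J_mul_conjTranspose h]
  have := mul_diagonal_mul_J_mul_apply (mat h) 1 i j
  rw [Pi.one_def, Matrix.diagonal_one, Matrix.mul_one] at this
  rw [this]
  simp

theorem mat_conj_diagonal {g : Sp n} {l : Idx n → ℍ} (hg : mat g = Matrix.diagonal l) (h : Sp n) :
    mat (h * g * h⁻¹) = mat h * Matrix.diagonal l * J n * (mat h)ᴴ * J n := by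
  rw [mat_mul, mat_mul, mat_inv, hg]
  simp only [Matrix.mul_assoc]

theorem J_inr_self (k : Fin 2) : J n (Sum.inr k) (Sum.inr k) = 0 := by
  fin_cases k <;> simp [J]

theorem self_mul_star_sum {ι : Type*} [Fintype ι] (x : ι → ℍ) :
    ∑ i, x i * star (x i) = ((∑ i, ‖x i‖ ^ 2 : ℝ) : ℍ) := by
  rw [← star_dotProduct_self]
  refine Finset.sum_congr rfl fun i _ => ?_
  rw [Pi.star_apply, Quaternion.star_mul_self, Quaternion.self_mul_star]

theorem row_sum_norm_sq_le (h : Sp n) (k : Fin 2) :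
    ∑ i, ‖mat h (Sum.inr k) (Sum.inl i)‖ ^ 2 ≤
      2 * (‖mat h (Sum.inr k) (Sum.inr 0)‖ * ‖mat h (Sum.inr k) (Sum.inr 1)‖) := by
  have h1 := row_relation h (Sum.inr k) (Sum.inr k)
  rw [J_inr_self, self_mul_star_sum, sub_eq_zero] at h1
  have h2 := congrArg norm h1
  rw [Quaternion.norm_coe, Real.norm_of_nonneg (Finset.sum_nonneg fun _ _ => by positivity)] at h2
  rw [h2]
  refine (norm_add_le _ _).trans ?_
  rw [norm_mul, norm_mul, Quaternion.norm_star, Quaternion.norm_star]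
  linarith

theorem row_sum_norm_sq_inl_le (h : Sp n) (j : Fin (n - 1)) :
    ∑ i, ‖mat h (Sum.inl j) (Sum.inl i)‖ ^ 2 ≤
      1 + 2 * (‖mat h (Sum.inl j) (Sum.inr 0)‖ * ‖mat h (Sum.inl j) (Sum.inr 1)‖) := by
  have h1 := row_relation h (Sum.inl j) (Sum.inl j)
  have hJ : J n (Sum.inl j) (Sum.inl j) = 1 := by simp [J]
  rw [hJ, self_mul_star_sum, sub_eq_iff_eq_add] at h1
  have h2 := congrArg norm h1
  rw [Quaternion.norm_coe, Real.norm_of_nonneg (Finset.sum_nonneg fun _ _ => by positivity)] at h2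
  rw [h2]
  refine (norm_add_le _ _).trans ?_
  refine add_le_add norm_one.le ((norm_add_le _ _).trans ?_)
  rw [norm_mul, norm_mul, Quaternion.norm_star, Quaternion.norm_star]
  linarith

theorem col_sum_norm_sq_le (h : Sp n) (k : Fin 2) :
    ∑ i, ‖mat h (Sum.inl i) (Sum.inr k)‖ ^ 2 ≤
      2 * (‖mat h (Sum.inr 0) (Sum.inr k)‖ * ‖mat h (Sum.inr 1) (Sum.inr k)‖) := by
  have := sum_norm_sq_le_of_null (herm_mat_nullVec_self h k)
  simpa only [mulVec_nullVec] using this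

/-- The off-diagonal corner entries of `h g h⁻¹`. -/
theorem norm_conj_apply_le {g : Sp n} {l : Idx n → ℍ} (hg : mat g = Matrix.diagonal l) (h : Sp n)
    {δ : ℝ} (hδ : 0 ≤ δ) (hl : ∀ i, ‖l (Sum.inl i) - 1‖ ≤ δ) (k m : Fin 2) (hkm : k ≠ m) :
    ‖mat (h * g * h⁻¹) (Sum.inr k) (Sum.inr m)‖ ≤
      (2 * δ + ‖l (Sum.inr 0) - 1‖ + ‖l (Sum.inr 1) - 1‖) *
        (‖mat h (Sum.inr k) (Sum.inr 0)‖ * ‖mat h (Sum.inr k) (Sum.inr 1)‖) := by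
  -- Right multiplication by `J` exchanges the last two columns up to sign, so the entry sought is a
  -- diagonal entry of `h diag(l) J h*`, where the row relation has right-hand side `0`.
  have e : mat (h * g * h⁻¹) (Sum.inr k) (Sum.inr m) =
      -(mat h * Matrix.diagonal l * J n * (mat h)ᴴ) (Sum.inr k) (Sum.inr k) := by
    rw [mat_conj_diagonal hg]
    fin_cases k <;> fin_cases m <;>
      first | exact absurd rfl hkm | exact (mul_J_apply_inr _ _).1 | exact (mul_J_apply_inr _ _).2
  have h1 := row_relation h (Sum.inr k) (Sum.inr k)
  rw [J_inr_self] at h1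
  rw [e, norm_neg, mul_diagonal_mul_J_mul_apply, ← sub_zero (_ - _), ← h1]
  have h2 : ∀ x y : Fin (n - 1) → ℍ, ∀ p q p' q' : ℍ,
      ∑ i, x i - (p + q) - (∑ i, y i - (p' + q')) =
        ∑ i, (x i - y i) - ((p - p') + (q - q')) := by
    intro x y p q p' q'
    rw [Finset.sum_sub_distrib]
    abel
  have h3 : ∀ x y z : ℍ, x * y * z - x * z = x * (y - 1) * z := by
    intro x y z
    rw [mul_sub, sub_mul, mul_one]
  rw [h2]
  simp only [h3]
  set s := ‖mat h (Sum.inr k) (Sum.inr 0)‖ * ‖mat h (Sum.inr k) (Sum.inr 1)‖ with hs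
  have hs0 : 0 ≤ s := by positivity
  have h4 := norm_sum_mul_mul_le hδ hl (row_sum_norm_sq_le h k) (row_sum_norm_sq_le h k)
  rw [Real.mul_self_sqrt hs0] at h4
  calc _ ≤ _ := norm_sub_le _ _
    _ ≤ _ := add_le_add h4 (norm_add_le _ _)
    _ = _ := by
      simp only [norm_mul, Quaternion.norm_star]
      rw [hs]
      ring

/-- The diagonal corner entries of `h g h⁻¹`. -/
theorem norm_conj_apply_sub_le {g : Sp n} {l : Idx n → ℍ} (hg : mat g = Matrix.diagonal l)
    (h : Sp n) (hl : ∀ i, ‖l (Sum.inl i)‖ = 1) :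
    ‖mat (h * g * h⁻¹) (Sum.inr 0) (Sum.inr 0) - mat h (Sum.inr 0) (Sum.inr 0) * l (Sum.inr 0) *
        star (mat h (Sum.inr 1) (Sum.inr 1))‖ ≤
      ‖l (Sum.inr 1)‖ * offCorner h ^ 2 + 2 * (diagCorner h * offCorner h) ∧
    ‖mat (h * g * h⁻¹) (Sum.inr 1) (Sum.inr 1) - mat h (Sum.inr 1) (Sum.inr 1) * l (Sum.inr 1) *
        star (mat h (Sum.inr 0) (Sum.inr 0))‖ ≤
      ‖l (Sum.inr 0)‖ * offCorner h ^ 2 + 2 * (diagCorner h * offCorner h) := by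
  have hoff : offCorner h ^ 2 = _ := Real.sq_sqrt (by positivity)
  have hs : √(‖mat h (Sum.inr 0) (Sum.inr 0)‖ * ‖mat h (Sum.inr 0) (Sum.inr 1)‖) *
      √(‖mat h (Sum.inr 1) (Sum.inr 0)‖ * ‖mat h (Sum.inr 1) (Sum.inr 1)‖) =
      diagCorner h * offCorner h := by
    rw [diagCorner, offCorner, ← Real.sqrt_mul (by positivity), ← Real.sqrt_mul (by positivity)]
    congr 1
    ring
  have b0 := norm_sum_mul_mul_le zero_le_one (fun i => (hl i).le)
    (row_sum_norm_sq_le h 0) (row_sum_norm_sq_le h 1)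
  have b1 := norm_sum_mul_mul_le zero_le_one (fun i => (hl i).le)
    (row_sum_norm_sq_le h 1) (row_sum_norm_sq_le h 0)
  rw [mul_comm (√_) (√_)] at b1
  rw [hs, one_mul] at b0 b1
  have h2 : ∀ s p q : ℍ, -(s - (p + q)) - p = q - s := by intros; abel
  have h3 : ∀ s p q : ℍ, -(s - (p + q)) - q = p - s := by intros; abel
  rw [mat_conj_diagonal hg, (mul_J_apply_inr _ _).1, (mul_J_apply_inr _ _).2,
    mul_diagonal_mul_J_mul_apply, mul_diagonal_mul_J_mul_apply]
  constructor
  · rw [h2, hoff]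
    refine (norm_sub_le _ _).trans (add_le_add (le_of_eq ?_) b0)
    simp only [norm_mul, Quaternion.norm_star]
    ring
  · rw [h3, hoff]
    refine (norm_sub_le _ _).trans (add_le_add (le_of_eq ?_) b1)
    simp only [norm_mul, Quaternion.norm_star]
    ring

/-! ### Convergence of the iterated conjugates -/

/-- The sequence `h, h g h⁻¹, …` in which each term conjugates `g` by the previous one. -/
def conjSeq (g h : Sp n) : ℕ → Sp n
  | 0 => h
  | k + 1 => conjSeq g h k * g * (conjSeq g h k)⁻¹

/-- Multiply the estimates `|b'| ≤ M|a||b|` and `|c'| ≤ M|c||d|` and take the square root. -/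
theorem offCorner_conj_le {g : Sp n} {l : Idx n → ℍ} (hg : mat g = Matrix.diagonal l) (h : Sp n)
    {δ : ℝ} (hδ : 0 ≤ δ) (hl : ∀ i, ‖l (Sum.inl i) - 1‖ ≤ δ) :
    offCorner (h * g * h⁻¹) ≤ (2 * δ + ‖l (Sum.inr 0) - 1‖ + ‖l (Sum.inr 1) - 1‖) *
      (diagCorner h * offCorner h) := by
  have h0 := norm_conj_apply_le hg h hδ hl 0 1 (by decide)
  have h1 := norm_conj_apply_le hg h hδ hl 1 0 (by decide)
  set M := 2 * δ + ‖l (Sum.inr 0) - 1‖ + ‖l (Sum.inr 1) - 1‖ with hM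
  have hM0 : 0 ≤ M := by positivity
  rw [offCorner, Real.sqrt_le_iff]
  refine ⟨mul_nonneg hM0 (mul_nonneg (diagCorner_nonneg h) (offCorner_nonneg h)), ?_⟩
  have h2 : diagCorner h ^ 2 = _ := Real.sq_sqrt (by positivity)
  have h3 : offCorner h ^ 2 = _ := Real.sq_sqrt (by positivity)
  rw [mul_pow, mul_pow, h2, h3]
  refine (mul_le_mul h0 h1 (norm_nonneg _) (by positivity)).trans (le_of_eq ?_)
  ring

section Limits

variable {g h : Sp n} {l : Idx n → ℍ} {δ : ℝ}

theorem tendsto_offCorner_conjSeq (hg : mat g = Matrix.diagonal l) (hδ : 0 ≤ δ)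
    (hl : ∀ i, ‖l (Sum.inl i) - 1‖ ≤ δ)
    (hM : (2 * δ + ‖l (Sum.inr 0) - 1‖ + ‖l (Sum.inr 1) - 1‖) * (1 + offCorner h) < 1 ∨
      (2 * δ + ‖l (Sum.inr 0) - 1‖ + ‖l (Sum.inr 1) - 1‖) * (1 + diagCorner h) < 1) :
    Tendsto (fun k => offCorner (conjSeq g h k)) atTop (𝓝 0) := by
  have step := fun k => offCorner_conj_le hg (conjSeq g h k) hδ hl
  set M := 2 * δ + ‖l (Sum.inr 0) - 1‖ + ‖l (Sum.inr 1) - 1‖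
  have hM0 : 0 ≤ M := by positivity
  have hx0 := diagCorner_nonneg h
  have hy0 := offCorner_nonneg h
  have step' : ∀ k, offCorner (conjSeq g h (k + 1)) ≤
      M * (1 + offCorner (conjSeq g h k)) * offCorner (conjSeq g h k) := by
    intro k
    refine (step k).trans ?_
    rw [mul_assoc]
    exact mul_le_mul_of_nonneg_left
      (mul_le_mul_of_nonneg_right (diagCorner_le _) (offCorner_nonneg _)) hM0
  -- After one step the two alternatives merge: with `x = |ad|^{1/2}` and `y = |bc|^{1/2}`, the new
  -- `y` is at most `y` in the first case and at most `M x (1 + x) ≤ x` in the second.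
  have h1 : M * (1 + offCorner (conjSeq g h 1)) < 1 := by
    rcases hM with hM | hM
    · have : offCorner (conjSeq g h 1) ≤ offCorner h :=
        (step' 0).trans (mul_le_of_le_one_left hy0 hM.le)
      exact (mul_le_mul_of_nonneg_left (by linarith) hM0).trans_lt hM
    · have : offCorner (conjSeq g h 1) ≤ diagCorner h := by
        refine (step 0).trans ?_
        calc M * (diagCorner h * offCorner h) ≤ M * (diagCorner h * (1 + diagCorner h)) := by
              gcongr
              exact offCorner_le h
          _ = M * (1 + diagCorner h) * diagCorner h := by ring
          _ ≤ diagCorner h := mul_le_of_le_one_left hx0 hM.le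
      exact (mul_le_mul_of_nonneg_left (by linarith) hM0).trans_lt hM
  set ρ := M * (1 + offCorner (conjSeq g h 1)) with hρ
  have hρ0 : 0 ≤ ρ := mul_nonneg hM0 (by linarith [offCorner_nonneg (conjSeq g h 1)])
  have bound : ∀ k, offCorner (conjSeq g h (k + 1)) ≤ offCorner (conjSeq g h 1) * ρ ^ k := by
    intro k
    induction k with
    | zero => simp
    | succ k ih =>
      have hle : offCorner (conjSeq g h (k + 1)) ≤ offCorner (conjSeq g h 1) :=
        ih.trans (mul_le_of_le_one_right (offCorner_nonneg _) (pow_le_one₀ hρ0 h1.le))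
      calc offCorner (conjSeq g h (k + 1 + 1)) ≤ _ := step' (k + 1)
        _ ≤ ρ * (offCorner (conjSeq g h 1) * ρ ^ k) := by
            refine mul_le_mul ?_ ih (offCorner_nonneg _) hρ0
            exact mul_le_mul_of_nonneg_left (by linarith) hM0
        _ = _ := by ring
  rw [← tendsto_add_atTop_iff_nat 1]
  refine squeeze_zero (fun k => offCorner_nonneg _) bound ?_
  simpa using (tendsto_pow_atTop_nhds_zero_of_lt_one hρ0 h1).const_mul (offCorner (conjSeq g h 1))

theorem tendsto_diagCorner {s : ℕ → Sp n} (hs : Tendsto (fun k => offCorner (s k)) atTop (𝓝 0)) :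
    Tendsto (fun k => diagCorner (s k)) atTop (𝓝 1) := by
  refine tendsto_of_tendsto_of_tendsto_of_le_of_le (g := fun k => 1 - offCorner (s k))
    (h := fun k => 1 + offCorner (s k)) ?_ ?_ (fun k => ?_) (fun k => diagCorner_le _)
  · simpa using hs.const_sub 1
  · simpa using hs.const_add 1
  · have := one_le_diagCorner_add_offCorner (s k)
    change 1 - offCorner (s k) ≤ diagCorner (s k)
    linarith

/-- The diagonal corner of `h_{k+1}` has modulus `|λ_i| |a_k d_k|` up to an error that vanishes with
`|b_k c_k|`, and `|a_k d_k| → 1`. -/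
theorem tendsto_norm_diag_conjSeq (hg : mat g = Matrix.diagonal l)
    (hl : ∀ i, ‖l (Sum.inl i)‖ = 1)
    (hs : Tendsto (fun k => offCorner (conjSeq g h k)) atTop (𝓝 0)) (i : Fin 2) :
    Tendsto (fun k => ‖mat (conjSeq g h k) (Sum.inr i) (Sum.inr i)‖) atTop
      (𝓝 ‖l (Sum.inr i)‖) := by
  have hd := tendsto_diagCorner hs
  have hlim : ∀ c : ℝ, Tendsto (fun k => c * offCorner (conjSeq g h k) ^ 2 +
      2 * (diagCorner (conjSeq g h k) * offCorner (conjSeq g h k))) atTop (𝓝 0) := by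
    intro c
    simpa using ((hs.pow 2).const_mul c).add ((hd.mul hs).const_mul 2)
  have hmain : Tendsto (fun k => ‖l (Sum.inr i)‖ * diagCorner (conjSeq g h k) ^ 2) atTop
      (𝓝 ‖l (Sum.inr i)‖) := by
    simpa using (hd.pow 2).const_mul ‖l (Sum.inr i)‖
  have hsq : ∀ k, ‖l (Sum.inr i)‖ * diagCorner (conjSeq g h k) ^ 2 =
      ‖mat (conjSeq g h k) (Sum.inr i) (Sum.inr i) * l (Sum.inr i) *
        star (mat (conjSeq g h k) (Sum.inr (1 - i)) (Sum.inr (1 - i)))‖ := by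
    intro k
    rw [diagCorner, Real.sq_sqrt (by positivity), norm_mul, norm_mul, Quaternion.norm_star]
    fin_cases i <;> simp <;> ring
  obtain ⟨c, hc⟩ : ∃ c : ℝ, ∀ k, |‖mat (conjSeq g h (k + 1)) (Sum.inr i) (Sum.inr i)‖ -
      ‖l (Sum.inr i)‖ * diagCorner (conjSeq g h k) ^ 2| ≤ c * offCorner (conjSeq g h k) ^ 2 +
      2 * (diagCorner (conjSeq g h k) * offCorner (conjSeq g h k)) := by
    refine ⟨‖l (Sum.inr (1 - i))‖, fun k => ?_⟩
    rw [hsq]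
    refine (abs_norm_sub_norm_le _ _).trans ?_
    have := norm_conj_apply_sub_le hg (conjSeq g h k) hl
    fin_cases i
    · exact this.1
    · exact this.2
  rw [← tendsto_add_atTop_iff_nat 1]
  have h0 := squeeze_zero_norm (fun k => (Real.norm_eq_abs _).trans_le (hc k)) (hlim c)
  simpa using h0.add hmain

/-- Each step multiplies the entry by at most `M` times the modulus of the diagonal corner in its
row, which tends to `|λ_i|`. After division by `|λ_i|^k` the ratio is eventually below `(M + 1) / 2
< 1`. Without the division the entry might grow when `|λ_i| > 1`. -/
theorem tendsto_norm_offDiag_conjSeq (hg : mat g = Matrix.diagonal l) (hδ : 0 ≤ δ)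
    (hl : ∀ i, ‖l (Sum.inl i) - 1‖ ≤ δ)
    (hM : 2 * δ + ‖l (Sum.inr 0) - 1‖ + ‖l (Sum.inr 1) - 1‖ < 1) {i j : Fin 2} (hij : i ≠ j)
    (hli : 0 < ‖l (Sum.inr i)‖)
    (hs : Tendsto (fun k => ‖mat (conjSeq g h k) (Sum.inr i) (Sum.inr i)‖) atTop
      (𝓝 ‖l (Sum.inr i)‖)) :
    Tendsto (fun k => ‖mat (conjSeq g h k) (Sum.inr i) (Sum.inr j)‖ / ‖l (Sum.inr i)‖ ^ k) atTop
      (𝓝 0) := by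
  have step := fun k => norm_conj_apply_le hg (conjSeq g h k) hδ hl i j hij
  set M := 2 * δ + ‖l (Sum.inr 0) - 1‖ + ‖l (Sum.inr 1) - 1‖
  have hM0 : 0 ≤ M := by positivity
  have hr : Tendsto (fun k => M * ‖mat (conjSeq g h k) (Sum.inr i) (Sum.inr i)‖ / ‖l (Sum.inr i)‖)
      atTop (𝓝 M) := by
    have := (hs.const_mul M).div_const ‖l (Sum.inr i)‖
    rwa [mul_div_assoc, div_self hli.ne', mul_one] at this
  have hM1 : M < (M + 1) / 2 := by linarith
  refine (summable_of_ratio_norm_eventually_le (r := (M + 1) / 2)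
    (by linarith) ?_).tendsto_atTop_zero
  filter_upwards [hr.eventually_lt_const hM1] with k hk
  rw [Real.norm_of_nonneg (by positivity), Real.norm_of_nonneg (by positivity)]
  have hprod : ‖mat (conjSeq g h k) (Sum.inr i) (Sum.inr 0)‖ *
      ‖mat (conjSeq g h k) (Sum.inr i) (Sum.inr 1)‖ =
      ‖mat (conjSeq g h k) (Sum.inr i) (Sum.inr i)‖ *
      ‖mat (conjSeq g h k) (Sum.inr i) (Sum.inr j)‖ := by
    fin_cases i <;> fin_cases j <;>
      first | exact absurd rfl hij | rfl | exact mul_comm _ _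
  have hst := step k
  rw [hprod] at hst
  calc _ ≤ M * (‖mat (conjSeq g h k) (Sum.inr i) (Sum.inr i)‖ *
        ‖mat (conjSeq g h k) (Sum.inr i) (Sum.inr j)‖) / ‖l (Sum.inr i)‖ ^ (k + 1) :=
        div_le_div_of_nonneg_right hst (by positivity)
    _ = M * ‖mat (conjSeq g h k) (Sum.inr i) (Sum.inr i)‖ / ‖l (Sum.inr i)‖ *
        (‖mat (conjSeq g h k) (Sum.inr i) (Sum.inr j)‖ / ‖l (Sum.inr i)‖ ^ k) := by
        field_simp
        ring
    _ ≤ _ := mul_le_mul_of_nonneg_right hk.le (by positivity)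

/-- Conjugates of the terms of even index which stay in a bounded set. -/
def twistedSeq (g h : Sp n) (k : ℕ) : Sp n := (g ^ k)⁻¹ * conjSeq g h (2 * k) * g ^ k

theorem mat_pow_eq_diagonal (hg : mat g = Matrix.diagonal l) (k : ℕ) :
    mat (g ^ k) = Matrix.diagonal (l ^ k) := by
  rw [← Matrix.diagonal_pow, ← hg]
  rfl

theorem norm_twistedSeq_apply (hg : mat g = Matrix.diagonal l) (k : ℕ) (i j : Idx n) :
    ‖l i‖ ^ k * ‖mat (twistedSeq g h k) i j‖ = ‖mat (conjSeq g h (2 * k)) i j‖ * ‖l j‖ ^ k := by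
  have h1 : mat (g ^ k) * mat (twistedSeq g h k) = mat (conjSeq g h (2 * k)) * mat (g ^ k) := by
    rw [← mat_mul, ← mat_mul, twistedSeq]
    congr 1
    group
  have h2 := congrArg norm (congrFun (congrFun h1 i) j)
  rw [mat_pow_eq_diagonal hg, Matrix.diagonal_mul, Matrix.mul_diagonal, norm_mul, norm_mul,
    Pi.pow_apply, Pi.pow_apply, norm_pow, norm_pow] at h2
  exact h2

/-- Conjugation by `g^k` leaves the moduli of diagonal entries unchanged and divides the
off-diagonal corner in row `i` by `|λ_i|^{2k}`, because `|λ_i||λ_j| = 1`. This is the normalisation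
needed at index `2k`. -/
theorem tendsto_norm_twistedSeq (hg : mat g = Matrix.diagonal l) (hδ : 0 ≤ δ)
    (hl : ∀ i, ‖l (Sum.inl i) - 1‖ ≤ δ) (hl1 : ∀ i, ‖l (Sum.inl i)‖ = 1)
    (hl01 : ‖l (Sum.inr 0)‖ * ‖l (Sum.inr 1)‖ = 1)
    (hM : (2 * δ + ‖l (Sum.inr 0) - 1‖ + ‖l (Sum.inr 1) - 1‖) * (1 + offCorner h) < 1 ∨
      (2 * δ + ‖l (Sum.inr 0) - 1‖ + ‖l (Sum.inr 1) - 1‖) * (1 + diagCorner h) < 1) (i j : Fin 2) :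
    Tendsto (fun k => ‖mat (twistedSeq g h k) (Sum.inr i) (Sum.inr j)‖) atTop
      (𝓝 (if i = j then ‖l (Sum.inr i)‖ else 0)) := by
  have hoff := tendsto_offCorner_conjSeq hg hδ hl hM
  have hdiag := tendsto_norm_diag_conjSeq hg hl1 hoff i
  have hli : 0 < ‖l (Sum.inr i)‖ := by
    have hne : ‖l (Sum.inr 0)‖ * ‖l (Sum.inr 1)‖ ≠ 0 := by rw [hl01]; exact one_ne_zero
    fin_cases i
    · exact lt_of_le_of_ne (norm_nonneg _) (left_ne_zero_of_mul hne).symm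
    · exact lt_of_le_of_ne (norm_nonneg _) (right_ne_zero_of_mul hne).symm
  have h2 : Tendsto (fun k : ℕ => 2 * k) atTop atTop :=
    tendsto_id.const_mul_atTop' two_pos
  split_ifs with hij
  · subst hij
    refine (hdiag.comp h2).congr fun k => ?_
    have := norm_twistedSeq_apply (h := h) hg k (Sum.inr i) (Sum.inr i)
    rw [mul_comm] at this
    exact (mul_right_cancel₀ (pow_pos hli k).ne' this).symm
  · have hM1 : 2 * δ + ‖l (Sum.inr 0) - 1‖ + ‖l (Sum.inr 1) - 1‖ < 1 := by
      have hM0 : 0 ≤ 2 * δ + ‖l (Sum.inr 0) - 1‖ + ‖l (Sum.inr 1) - 1‖ := by positivity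
      rcases hM with hM | hM
      · exact (le_mul_of_one_le_right hM0 (by linarith [offCorner_nonneg h])).trans_lt hM
      · exact (le_mul_of_one_le_right hM0 (by linarith [diagCorner_nonneg h])).trans_lt hM
    have hz := tendsto_norm_offDiag_conjSeq hg hδ hl hM1 hij hli hdiag
    refine (hz.comp h2).congr fun k => ?_
    have hlij : ‖l (Sum.inr i)‖ * ‖l (Sum.inr j)‖ = 1 := by
      fin_cases i <;> fin_cases j <;>
        first | exact absurd rfl hij | exact hl01 | exact (mul_comm _ _).trans hl01
    have := norm_twistedSeq_apply (h := h) hg k (Sum.inr i) (Sum.inr j)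
    have hk : ‖l (Sum.inr i)‖ ^ k * ‖l (Sum.inr j)‖ ^ k = 1 := by
      rw [← mul_pow, hlij, one_pow]
    have hpow : ‖l (Sum.inr i)‖ ^ (2 * k) = ‖l (Sum.inr i)‖ ^ k * ‖l (Sum.inr i)‖ ^ k := by
      rw [two_mul, pow_add]
    rw [Function.comp_apply, div_eq_iff (pow_pos hli _).ne', hpow]
    linear_combination (-‖l (Sum.inr i)‖ ^ k) * this -
      ‖mat (conjSeq g h (2 * k)) (Sum.inr i) (Sum.inr j)‖ * hk

end Limits

/-! ### Bounded sequences in discrete subgroups -/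

/-- The entries of an element of `Sp(n,1)` are bounded in terms of the four corner entries. -/
theorem norm_apply_le_of_corner_le {s : Sp n} {R : ℝ} (hR : 1 ≤ R)
    (hs : ∀ i j : Fin 2, ‖mat s (Sum.inr i) (Sum.inr j)‖ ≤ R) (i j : Idx n) :
    ‖mat s i j‖ ≤ 3 * R := by
  have hR0 : 0 ≤ R := zero_le_one.trans hR
  have single : ∀ (x : Fin (n - 1) → ℍ) (C : ℝ), ∑ i, ‖x i‖ ^ 2 ≤ C → ∀ i, ‖x i‖ ^ 2 ≤ C :=
    fun x C hC i => (Finset.single_le_sum (f := fun i => ‖x i‖ ^ 2)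
      (fun _ _ => by positivity) (Finset.mem_univ i)).trans hC
  have prod : ∀ a b : ℝ, 0 ≤ b → a ≤ R → b ≤ R → a * b ≤ R * R :=
    fun a b hb ha hb' => mul_le_mul ha hb' hb hR0
  have hrow : ∀ k i, ‖mat s (Sum.inr k) (Sum.inl i)‖ ^ 2 ≤ 2 * (R * R) := fun k =>
    single _ _ ((row_sum_norm_sq_le s k).trans
      (by linarith [prod _ _ (norm_nonneg _) (hs k 0) (hs k 1)]))
  have hcol : ∀ k i, ‖mat s (Sum.inl i) (Sum.inr k)‖ ^ 2 ≤ 2 * (R * R) := fun k =>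
    single (fun i => mat s (Sum.inl i) (Sum.inr k)) _ ((col_sum_norm_sq_le s k).trans
      (by linarith [prod _ _ (norm_nonneg _) (hs 0 k) (hs 1 k)]))
  have hsq : ∀ x : ℝ, x ^ 2 ≤ 9 * (R * R) → x ≤ 3 * R := fun x hx => by
    nlinarith [abs_le_of_sq_le_sq (a := x) (b := 3 * R) (by linarith) (by linarith)]
  have hRR : 1 ≤ R * R := by nlinarith
  rcases i with i | i <;> rcases j with j | j
  -- Here `1 + 2xy ≤ 1 + x² + y² ≤ 5R²`, using `R ≥ 1`.
  · refine hsq _ (single _ _ ((row_sum_norm_sq_inl_le s i).trans ?_) j)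
    have h0 := hcol 0 i
    have h1 := hcol 1 i
    nlinarith [sq_nonneg (‖mat s (Sum.inl i) (Sum.inr 0)‖ - ‖mat s (Sum.inl i) (Sum.inr 1)‖)]
  · exact hsq _ ((hcol j i).trans (by linarith))
  · exact hsq _ ((hrow i j).trans (by linarith))
  · exact (hs i j).trans (by linarith)

/-- The topology is that of a group of units, so convergence has to be checked for the inverses as
well. -/
theorem isInducing_mat_prod_inv :
    IsInducing (fun g : Sp n => (mat g, MulOpposite.op (mat g⁻¹))) :=
  Units.isInducing_embedProduct.comp IsInducing.subtypeVal

/-- A sequence in a discrete subgroup with bounded entries takes some value infinitely often. -/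
theorem exists_eventually_eq_of_discrete {G : Subgroup (Sp n)} (hG : IsDiscreteSubgroup G)
    (f : Sp n) {s : ℕ → Sp n} (hs : ∀ k, s k ∈ G) {R : ℝ}
    (hR : ∀ k i j, ‖mat (f * s k * f⁻¹) i j‖ ≤ R) :
    ∃ (φ : ℕ → ℕ) (t : Sp n), StrictMono φ ∧ ∀ᶠ k in atTop, s (φ k) = t := by
  let F : ℕ → Matrix (Idx n) (Idx n) ℍ := fun k => mat (f * s k * f⁻¹)
  have hcomp : IsCompact (Set.univ.pi fun _ => Set.univ.pi fun _ => Metric.closedBall (0 : ℍ) R :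
      Set (Idx n → Idx n → ℍ)) :=
    isCompact_univ_pi fun _ => isCompact_univ_pi fun _ => isCompact_closedBall _ _
  let F' : ℕ → Idx n → Idx n → ℍ := F
  obtain ⟨M, -, φ, hφ, hM⟩ := hcomp.tendsto_subseq (x := F')
    (fun k i _ j _ => by simpa using hR k i j)
  have hM' : Tendsto (fun k => F (φ k)) atTop (𝓝 (M : Matrix (Idx n) (Idx n) ℍ)) := hM
  -- `J X* J Y` equals `X⁻¹ Y` on the group and is continuous on all matrices. Hence quotients of
  -- consecutive terms tend to `1`, and discreteness makes them eventually equal to `1`.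
  let Φ : Matrix (Idx n) (Idx n) ℍ × Matrix (Idx n) (Idx n) ℍ → Matrix (Idx n) (Idx n) ℍ :=
    fun p => J n * p.1ᴴ * J n * p.2
  have hΦ : Continuous Φ := ((continuous_const.mul continuous_fst.matrix_conjTranspose).mul
    continuous_const).mul continuous_snd
  have hself : ∀ k, Φ (F k, F k) = 1 := fun k => by
    change J n * (F k)ᴴ * J n * F k = 1
    rw [← mat_inv, ← mat_mul, inv_mul_cancel, mat_one]
  have hlim1 : Φ (M, M) = 1 := by
    have := (hΦ.tendsto (M, M)).comp (hM'.prodMk_nhds hM')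
    refine tendsto_nhds_unique this ?_
    simp only [Function.comp_def, hself]
    exact tendsto_const_nhds
  let d : ℕ → Sp n := fun k => (s (φ k))⁻¹ * s (φ (k + 1))
  have hd : ∀ k, mat (d k) = mat f⁻¹ * Φ (F (φ k), F (φ (k + 1))) * mat f := by
    intro k
    change _ = mat f⁻¹ * (J n * (F (φ k))ᴴ * J n * F (φ (k + 1))) * mat f
    rw [← mat_inv, ← mat_mul, ← mat_mul, ← mat_mul]
    congr 1
    simp only [d]
    group
  have hlim2 : Tendsto (fun k => mat (d k)) atTop (𝓝 1) := by
    have h1 := (hΦ.tendsto (M, M)).comp (hM'.prodMk_nhds (hM'.comp (tendsto_add_atTop_nat 1)))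
    have h2 := (h1.const_mul (mat f⁻¹)).mul_const (mat f)
    rw [hlim1, Matrix.mul_one, ← mat_mul, inv_mul_cancel, mat_one] at h2
    simp only [hd]
    exact h2
  have hlim3 : Tendsto (fun k => mat (d k)⁻¹) atTop (𝓝 1) := by
    have hc : Continuous fun X : Matrix (Idx n) (Idx n) ℍ => J n * Xᴴ * J n :=
      (continuous_const.mul continuous_id.matrix_conjTranspose).mul continuous_const
    have h1 := (hc.tendsto 1).comp hlim2
    rw [Matrix.conjTranspose_one, Matrix.mul_one, J_mul_J] at h1
    refine h1.congr fun k => ?_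
    rw [Function.comp_apply, mat_inv]
  have hdG : ∀ k, d k ∈ G := fun k => G.mul_mem (G.inv_mem (hs _)) (hs _)
  have hlim4 : Tendsto (fun k => (⟨d k, hdG k⟩ : G)) atTop (𝓝 1) := by
    rw [IsInducing.subtypeVal.tendsto_nhds_iff, isInducing_mat_prod_inv.tendsto_nhds_iff]
    refine Tendsto.prodMk_nhds hlim2 ?_
    exact (MulOpposite.continuous_op.tendsto _).comp (by simpa [mat_one] using hlim3)
  have : DiscreteTopology G := hG
  rw [nhds_discrete, tendsto_pure, eventually_atTop] at hlim4
  obtain ⟨N, hN⟩ := hlim4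
  refine ⟨φ, s (φ N), hφ, eventually_atTop.mpr ⟨N, fun k hk => ?_⟩⟩
  induction k, hk using Nat.le_induction with
  | base => rfl
  | succ k hk ih =>
    have : d k = 1 := congrArg Subtype.val (hN k hk)
    rw [← ih]
    exact (inv_mul_eq_one.mp this).symm

/-! ### From discreteness to a term fixing both points -/

/-- In the conjugated frame the pairings between a standard null vector and an image of one have
corner entries as moduli. The remaining pairings have modulus `1`, since `h` is an isometry. -/
theorem absCrossRatio_eq {f h : Sp n} {u v : Pt n} (hu : f • u = nullPt n 0)
    (hv : f • v = nullPt n 1) :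
    absCrossRatio (h • u) v u (h • v) = offCorner (f * h * f⁻¹) ^ 2 ∧
      absCrossRatio (h • u) u v (h • v) = diagCorner (f * h * f⁻¹) ^ 2 := by
  have ne : ∀ (s : Sp n) {z : Vec n}, z ≠ 0 → mat s *ᵥ z ≠ 0 := fun s z hz =>
    (smul_mk_eq s z hz).choose
  have hu' : u = Projectivization.mk ℍᵐᵒᵖ _ (ne f⁻¹ (nullVec_ne_zero 0)) := by
    rw [← smul_mk_eq_of_mulVec (nullVec_ne_zero 0) _ rfl]
    exact eq_inv_smul_iff.mpr hu
  have hv' : v = Projectivization.mk ℍᵐᵒᵖ _ (ne f⁻¹ (nullVec_ne_zero 1)) := by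
    rw [← smul_mk_eq_of_mulVec (nullVec_ne_zero 1) _ rfl]
    exact eq_inv_smul_iff.mpr hv
  have hh : ∀ k, mat h *ᵥ (mat f⁻¹ *ᵥ nullVec n k) =
      mat f⁻¹ *ᵥ (mat (f * h * f⁻¹) *ᵥ nullVec n k) := by
    intro k
    rw [Matrix.mulVec_mulVec, Matrix.mulVec_mulVec, ← mat_mul, ← mat_mul]
    congr 2
    group
  have hhu : h • u = Projectivization.mk ℍᵐᵒᵖ _
      (ne f⁻¹ (ne (f * h * f⁻¹) (nullVec_ne_zero 0))) := by
    rw [hu']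
    exact smul_mk_eq_of_mulVec _ _ (hh 0)
  have hhv : h • v = Projectivization.mk ℍᵐᵒᵖ _
      (ne f⁻¹ (ne (f * h * f⁻¹) (nullVec_ne_zero 1))) := by
    rw [hv']
    exact smul_mk_eq_of_mulVec _ _ (hh 1)
  have hoff : offCorner (f * h * f⁻¹) ^ 2 = _ := Real.sq_sqrt (by positivity)
  have hdiag : diagCorner (f * h * f⁻¹) ^ 2 = _ := Real.sq_sqrt (by positivity)
  rw [hhu, hhv, hu', hv', absCrossRatio_mk, absCrossRatio_mk, hoff, hdiag]
  simp only [crossRatio, herm_mat, norm_mul, norm_inv, norm_herm_nullVec_zero_mat,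
    norm_herm_nullVec_one_mat, herm_nullVec_zero_one, herm_nullVec_one_zero]
  rw [norm_herm_comm _ (nullVec n 0), norm_herm_comm _ (nullVec n 1), norm_herm_nullVec_zero_mat,
    norm_herm_nullVec_one_mat]
  simp [mul_comm]

theorem conj_conjSeq (f g h : Sp n) (k : ℕ) :
    f * conjSeq g h k * f⁻¹ = conjSeq (f * g * f⁻¹) (f * h * f⁻¹) k := by
  induction k with
  | zero => rfl
  | succ k ih =>
    simp only [conjSeq]
    rw [← ih]
    group

theorem conj_twistedSeq (f g h : Sp n) (k : ℕ) :
    f * twistedSeq g h k * f⁻¹ = twistedSeq (f * g * f⁻¹) (f * h * f⁻¹) k := by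
  rw [twistedSeq, twistedSeq, ← conj_conjSeq, conj_pow]
  group

theorem conjSeq_mem {G : Subgroup (Sp n)} {g h : Sp n} (hg : g ∈ G) (hh : h ∈ G) (k : ℕ) :
    conjSeq g h k ∈ G := by
  induction k with
  | zero => exact hh
  | succ k ih => exact G.mul_mem (G.mul_mem ih hg) (G.inv_mem ih)

theorem smul_nullPt_eq_of_apply_eq_zero {s : Sp n} {k l : Fin 2} (hkl : k ≠ l)
    (h : mat s (Sum.inr k) (Sum.inr l) = 0) : s • nullPt n l = nullPt n l := by
  have h1 := eq_smul_nullVec_of_herm_self_eq_zero (herm_mat_nullVec_self s l) hkl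
    (by rw [mulVec_nullVec]; exact h)
  obtain ⟨h2, h3⟩ := smul_mk_eq s _ (nullVec_ne_zero (n := n) l)
  rw [nullPt, h3, Projectivization.mk_eq_mk_iff']
  exact ⟨_, h1.symm⟩

theorem exists_conjSeq_fixing {G : Subgroup (Sp n)} (hG : IsDiscreteSubgroup G) {g h : Sp n}
    (hgG : g ∈ G) (hhG : h ∈ G) {u v : Pt n} (hg : IsLoxodromic g) (huv : fixedPts g = {u, v})
    (hM : Mg g * (1 + Real.sqrt (absCrossRatio (h • u) v u (h • v))) < 1 ∨
      Mg g * (1 + Real.sqrt (absCrossRatio (h • u) u v (h • v))) < 1) :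
    ∃ k, conjSeq g h (k + 1) • u = u ∧ conjSeq g h (k + 1) • v = v := by
  obtain ⟨f, l, hfu, hfv, hd, hl⟩ := exists_isDiagForm hg huv
  obtain ⟨hc1, hc2⟩ := absCrossRatio_eq (h := h) hfu hfv
  rw [hl.delta_eq_and_Mg_eq.2, hc1, hc2, Real.sqrt_sq (offCorner_nonneg _),
    Real.sqrt_sq (diagCorner_nonneg _)] at hM
  have hl01 : ‖l (Sum.inr 0)‖ * ‖l (Sum.inr 1)‖ = 1 := by
    have := congrArg norm hl.2.2.2
    rwa [norm_mul, Quaternion.norm_star, norm_one] at this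
  have hlim := tendsto_norm_twistedSeq hd (Real.iSup_nonneg fun i => norm_nonneg _)
    (fun i => le_ciSup (f := fun i : Fin (n - 1) => ‖l (Sum.inl i) - 1‖)
      (Set.finite_range _).bddAbove i) hl.2.1 hl01 hM
  choose R hR using fun i j => (hlim i j).bddAbove_range
  have hR' : ∀ i j k, ‖mat (f * twistedSeq g h k * f⁻¹) (Sum.inr i) (Sum.inr j)‖ ≤
      1 + ∑ i, ∑ j, |R i j| := by
    intro i j k
    rw [conj_twistedSeq]
    calc _ ≤ R i j := hR i j ⟨k, rfl⟩
      _ ≤ |R i j| := le_abs_self _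
      _ ≤ ∑ j, |R i j| :=
        Finset.single_le_sum (f := fun j => |R i j|) (fun _ _ => abs_nonneg _) (Finset.mem_univ j)
      _ ≤ ∑ i, ∑ j, |R i j| :=
        Finset.single_le_sum (f := fun i => ∑ j, |R i j|)
          (fun _ _ => Finset.sum_nonneg fun _ _ => abs_nonneg _) (Finset.mem_univ i)
      _ ≤ _ := by linarith
  have hsum : 0 ≤ ∑ i, ∑ j, |R i j| :=
    Finset.sum_nonneg fun _ _ => Finset.sum_nonneg fun _ _ => abs_nonneg _
  obtain ⟨φ, t, hφ, ht⟩ := exists_eventually_eq_of_discrete hG f (s := twistedSeq g h)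
    (fun k => G.mul_mem (G.mul_mem (G.inv_mem (G.pow_mem hgG k)) (conjSeq_mem hgG hhG _))
      (G.pow_mem hgG k))
    (fun k => norm_apply_le_of_corner_le (by linarith) (fun i j => hR' i j k))
  -- The subsequence is eventually equal to `t`, so the limits of the entries are entries of `t`
  -- itself.
  have hzero : ∀ i j : Fin 2, i ≠ j → mat (f * t * f⁻¹) (Sum.inr i) (Sum.inr j) = 0 := by
    intro i j hij
    have h1 := (hlim i j).comp hφ.tendsto_atTop
    rw [if_neg hij] at h1
    refine norm_eq_zero.mp (tendsto_nhds_unique ?_ h1)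
    refine tendsto_const_nhds.congr' ?_
    filter_upwards [ht] with k hk
    rw [Function.comp_apply, ← conj_twistedSeq, hk]
  -- `k ≥ 1` gives `φ k ≥ 1`, so that the index `2 * φ k` is a successor and the term is a conjugate
  -- of `g`.
  obtain ⟨k, hk, hk1⟩ := (ht.and (eventually_ge_atTop 1)).exists
  have hpos : 1 ≤ φ k := hk1.trans (hφ.le_apply)
  refine ⟨2 * φ k - 1, ?_⟩
  rw [show 2 * φ k - 1 + 1 = 2 * φ k by omega]
  have htfix : ∀ (i j : Fin 2), i ≠ j → (f * t * f⁻¹) • nullPt n j = nullPt n j :=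
    fun i j hij => smul_nullPt_eq_of_apply_eq_zero hij (hzero i j hij)
  have hgfix : ∀ p ∈ fixedPts g, ∀ m : ℕ, g ^ m • p = p := fun p hp m => by
    induction m with
    | zero => rw [pow_zero, one_smul]
    | succ m ih => rw [pow_succ, mul_smul, hp.2, ih]
  have key : ∀ p ∈ fixedPts g, (f * t * f⁻¹) • (f • p) = f • p →
      conjSeq g h (2 * φ k) • p = p := by
    intro p hp hfix
    rw [mul_smul, inv_smul_smul, mul_smul, smul_left_cancel_iff, ← hk, twistedSeq, mul_smul,
      mul_smul, hgfix p hp, inv_smul_eq_iff, hgfix p hp] at hfix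
    exact hfix
  constructor
  · exact key u (by rw [huv]; simp) (by rw [hfu]; exact htfix 1 0 (by decide))
  · exact key v (by rw [huv]; simp) (by rw [hfv]; exact htfix 0 1 (by decide))

/-! ### Descent to `h` and elementarity -/

theorem smul_mem_of_conj_smul_eq {g s : Sp n} (hg : IsLoxodromic g) {p : Pt n}
    (hp : p ∈ fixedPts g) (h : (s * g * s⁻¹) • p = p) : s⁻¹ • p ∈ fixedPts g := by
  refine ⟨Or.inr (smul_mem_bdry _ (hg.2.2 hp)), ?_⟩
  rw [mul_smul, mul_smul] at h
  rw [eq_inv_smul_iff, h]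

/-- If `s g s⁻¹` fixes `u` and `v`, then `s` permutes the fixed points of `g`. The descent stops at
index `1`: the exchange is excluded only for conjugates of `g`, and `h` need not be one. -/
theorem conjSeq_one_fixing {g h : Sp n} {u v : Pt n} (hg : IsLoxodromic g)
    (huv : fixedPts g = {u, v}) (k : ℕ)
    (hk : conjSeq g h (k + 1) • u = u ∧ conjSeq g h (k + 1) • v = v) :
    conjSeq g h 1 • u = u ∧ conjSeq g h 1 • v = v := by
  have hne := ne_of_fixedPts_eq hg huv
  have hu : u ∈ fixedPts g := by rw [huv]; simp
  have hv : v ∈ fixedPts g := by rw [huv]; simp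
  induction k with
  | zero => exact hk
  | succ k ih =>
    apply ih
    have hu' := smul_mem_of_conj_smul_eq hg hu hk.1
    have hv' := smul_mem_of_conj_smul_eq hg hv hk.2
    rw [huv, Set.mem_insert_iff, Set.mem_singleton_iff, inv_smul_eq_iff, inv_smul_eq_iff] at hu' hv'
    rcases hu' with hu' | hu' <;> rcases hv' with hv' | hv'
    · exact absurd (hu'.trans hv'.symm) hne
    · exact ⟨hu'.symm, hv'.symm⟩
    -- An exchange would give a conjugate of `g`, and hence `g`, a fixed point in hyperbolic space.
    · exact absurd (exists_fixed_mem_hypSpace_of_conj (exists_fixed_mem_hypSpace_of_exchange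
        (g := conjSeq g h (k + 1)) (hg.2.2 hu) (hg.2.2 hv) hne hv'.symm hu'.symm))
        (not_fixed_mem_hypSpace hg)
    · exact absurd (hu'.trans hv'.symm) hne

/-- A group preserving a pair of boundary points is elementary. -/
theorem isElementary_of_preserves_pair {G : Subgroup (Sp n)} {u v : Pt n} (hu : u ∈ bdry n)
    (hv : v ∈ bdry n) (huv : u ≠ v)
    (hG : ∀ a ∈ G, a • u ∈ ({u, v} : Set (Pt n)) ∧ a • v ∈ ({u, v} : Set (Pt n))) :
    IsElementary G := by
  have key : ∀ a ∈ G, ¬ IsElliptic a → u ∈ fixedPts a := by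
    intro a ha hell
    refine ⟨Or.inr hu, ?_⟩
    obtain ⟨h1, h2⟩ := hG a ha
    rcases h1 with h1 | h1
    · exact h1
    · exfalso
      rw [Set.mem_singleton_iff] at h1
      have h3 : a • v = u := by
        rcases h2 with h2 | h2
        · exact h2
        · exact absurd (smul_left_cancel a (h1.trans h2.symm)) huv
      -- An element exchanging `u` and `v` is elliptic, so a non-elliptic one fixes `u`.
      obtain ⟨p, hp, e⟩ := exists_fixed_mem_hypSpace_of_exchange hu hv huv h1 h3
      refine hell ⟨?_, p, ⟨Or.inl hp, e⟩, hp⟩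
      rintro rfl
      exact huv ((one_smul _ u).symm.trans h1)
  rintro ⟨a, ha, b, hb, ha', hb', -, -, hdisj⟩
  exact Set.disjoint_left.mp hdisj (key a ha ha') (key b hb hb')

open scoped Pointwise in
theorem closure_preserves_pair {g h : Sp n} {u v : Pt n} (hg : IsLoxodromic g)
    (huv : fixedPts g = {u, v}) (h1 : conjSeq g h 1 • u = u ∧ conjSeq g h 1 • v = v) :
    ∀ a ∈ Subgroup.closure {g, h},
      a • u ∈ ({u, v} : Set (Pt n)) ∧ a • v ∈ ({u, v} : Set (Pt n)) := by
  have hne := ne_of_fixedPts_eq hg huv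
  have hu : u ∈ fixedPts g := by rw [huv]; simp
  have hv : v ∈ fixedPts g := by rw [huv]; simp
  have hpair : ∀ s : Sp n, s • ({u, v} : Set (Pt n)) = {s • u, s • v} :=
    fun s => Set.image_pair (s • ·) u v
  have hle : Subgroup.closure {g, h} ≤ MulAction.stabilizer (Sp n) ({u, v} : Set (Pt n)) := by
    rw [Subgroup.closure_le]
    rintro a (rfl | rfl)
    · change a • ({u, v} : Set (Pt n)) = {u, v}
      rw [hpair, hu.2, hv.2]
    -- Unlike the later terms of the sequence, `h` may exchange `u` and `v`; invariance of the pair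
    -- is all that is needed.
    · have hu' := smul_mem_of_conj_smul_eq hg hu h1.1
      have hv' := smul_mem_of_conj_smul_eq hg hv h1.2
      rw [huv] at hu' hv'
      change a⁻¹ • u ∈ _ at hu'
      change a⁻¹ • v ∈ _ at hv'
      rw [SetLike.mem_coe, ← inv_mem_iff]
      change a⁻¹ • ({u, v} : Set (Pt n)) = {u, v}
      rw [hpair]
      rcases hu' with hu' | hu' <;> rcases hv' with hv' | hv'
      · exact absurd (smul_left_cancel a⁻¹ (hu'.trans hv'.symm)) hne
      · rw [hu', hv']
      · rw [hu', hv', Set.pair_comm]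
      · exact absurd (smul_left_cancel a⁻¹ (hu'.trans hv'.symm)) hne
  intro a ha
  have hs : a • ({u, v} : Set (Pt n)) = {u, v} := hle ha
  constructor
  · rw [← hs]
    exact Set.smul_mem_smul_set (by simp)
  · rw [← hs]
    exact Set.smul_mem_smul_set (by simp)

end QuatHyp

end

theorem theorem1p1 (n : ℕ) (hn : 1 ≤ n) (g h : QuatHyp.Sp n) (u v : QuatHyp.Pt n)
    (hg : QuatHyp.IsLoxodromic g) (huv : QuatHyp.fixedPts g = {u, v})
    (hM : QuatHyp.Mg g * (1 + Real.sqrt (QuatHyp.absCrossRatio (h • u) v u (h • v))) < 1 ∨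
      QuatHyp.Mg g * (1 + Real.sqrt (QuatHyp.absCrossRatio (h • u) u v (h • v))) < 1) :
    QuatHyp.IsElementary (Subgroup.closure {g, h}) ∨
      ¬ QuatHyp.IsDiscreteSubgroup (Subgroup.closure {g, h}) := by
  refine or_iff_not_imp_right.mpr fun hG => ?_
  rw [not_not] at hG
  obtain ⟨k, hk⟩ := QuatHyp.exists_conjSeq_fixing hG (Subgroup.subset_closure (by simp))
    (Subgroup.subset_closure (by simp)) hg huv hM
  have h1 := QuatHyp.conjSeq_one_fixing hg huv k hk
  exact QuatHyp.isElementary_of_preserves_pair (hg.2.2 (by rw [huv]; simp))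
    (hg.2.2 (by rw [huv]; simp)) (QuatHyp.ne_of_fixedPts_eq hg huv)
    (QuatHyp.closure_preserves_pair hg huv h1)
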